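/- Let $E$ be an elliptic curve over $\mathbb{C}$ and let $\pi\colon E\to \mathbb{P}^1=E/\{\pm 1\}$ be the quotient map (the $x$-coordinate of a Weierstrass equation). For every positive integer $n$ there is a unique non-constant morphism $\langle n\rangle\colon\mathbb{P}^1\to\mathbb{P}^1$, the Lattès map, with $\pi\circ[n]=\langle n\rangle\circ\pi$, where $[n]$ is multiplication by $n$ on $E$. Let $K=\mathbb{C}(t)$ be the function field of $\mathbb{P}^1$. For each $n$, the function field of $\mathbb{P}^1$ is an extension of $K$ via pull-back by $\langle n\rangle$. Let $\ell,m>2$ be relatively prime integers, and let $L$, $M$ and $N$ be the extensions of $K$ given in this way by $\langle \ell\rangle$, $\langle m\rangle$ and $\langle \ell m\rangle$ respectively. Then $L/K$ and $M/K$ are finite; there is a set of exactly four valuations of $K$ (trivial on $\mathbb{C}$) that is the set of valuations over which $L$ is ramified and also the set of valuations over which $M$ is ramified; and $L\otimes_K M$ is a field, isomorphic as a $K$-algebra to $N$. Hence $L\otimes_K M$ has genus $0$, i.e. it is isomorphic over $\mathbb{C}$ to $\mathbb{C}(t)$. In particular, the bound $4$ is sharp in the theorem that, if $L\otimes_K M$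 is a field of genus $0$, then at least one of the finite extensions $L$, $M$ of $K$ is ramified over at most four valuations of $K$: there are finite extensions $L$ and $M$ of $K$, each ramified over exactly four valuations of $K$, such that $L\otimes_K M$ is a field of genus $0$. -/

import Mathlib

open scoped TensorProduct

noncomputable section

namespace Lattes

open Polynomial

/-! ### The projective line and its finite self-maps -/

/-- The point `[a : b]` of `ℙ¹(ℂ) = ℂ ∪ {∞}`, for `(a, b) ≠ (0, 0)`. -/
def ratio (a b : ℂ) : OnePoint ℂ :=
  open Classical in if b = 0 then OnePoint.infty else ((a / b : ℂ) : OnePoint ℂ)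

/-- The map `ℙ¹(ℂ) → ℙ¹(ℂ)` given by a rational function `f = p / q` in lowest terms. The value at
infinity is read off from the coefficients of degree `max (deg p) (deg q)` of `p` and `q`. -/
def evalP1 (f : RatFunc ℂ) : OnePoint ℂ → OnePoint ℂ
  | some a => ratio (f.num.eval a) (f.denom.eval a)
  | none => ratio (f.num.coeff (max f.num.natDegree f.denom.natDegree))
      (f.denom.coeff (max f.num.natDegree f.denom.natDegree))

/-- A non-constant morphism `ℙ¹ → ℙ¹` over `ℂ` is the same thing as a `ℂ`-algebra endomorphism `φ`
of the function field `ℂ(x)` (its pull-back); it is given on points by the rational function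
`φ x`. -/
def pointMap (φ : RatFunc ℂ →ₐ[ℂ] RatFunc ℂ) : OnePoint ℂ → OnePoint ℂ :=
  evalP1 (φ RatFunc.X)

/-! ### The quotient map of an elliptic curve by `±1` and the Lattès maps -/

/-- The quotient map `π : E → ℙ¹ = E / ±1`, which is the `x`-coordinate. -/
def quotMap (W : WeierstrassCurve ℂ) : W.toAffine.Point → OnePoint ℂ
  | .zero => OnePoint.infty
  | .some x _ _ => (x : OnePoint ℂ)

/-- The fibres of `π` are the orbits of `±1`. -/
theorem quotMap_eq_iff (W : WeierstrassCurve ℂ) (P Q : W.toAffine.Point) :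
    quotMap W P = quotMap W Q ↔ P = Q ∨ P = -Q := by
  rcases P with _ | ⟨x₁, y₁, h₁⟩ <;> rcases Q with _ | ⟨x₂, y₂, h₂⟩
  · simp
  · simp [quotMap, WeierstrassCurve.Affine.Point.neg_some]
  · simp [quotMap, ← WeierstrassCurve.Affine.Point.zero_def]
  · simp only [quotMap, WeierstrassCurve.Affine.Point.neg_some, OnePoint.coe_eq_coe,
      WeierstrassCurve.Affine.Point.some.injEq]
    constructor
    · rintro rfl
      simpa using WeierstrassCurve.Affine.Y_eq_of_X_eq h₁.1 h₂.1 rfl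
    · tauto

/-- `π` is onto. -/
theorem quotMap_surjective (W : WeierstrassCurve ℂ) [W.IsElliptic] :
    Function.Surjective (quotMap W) := by
  intro p
  induction p using OnePoint.rec with
  | infty => exact ⟨.zero, rfl⟩
  | coe x =>
    obtain ⟨y, hy⟩ := IsAlgClosed.exists_root
      (X ^ 2 + C (W.a₁ * x + W.a₃) * X - C (x ^ 3 + W.a₂ * x ^ 2 + W.a₄ * x + W.a₆) : ℂ[X]) (by
        have : (X ^ 2 + C (W.a₁ * x + W.a₃) * X
          - C (x ^ 3 + W.a₂ * x ^ 2 + W.a₄ * x + W.a₆) : ℂ[X]).degree = 2 := by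
            compute_degree!
        rw [this]; norm_num)
    have h : W.toAffine.Equation x y := by
      rw [WeierstrassCurve.Affine.equation_iff]
      simp only [IsRoot.def, eval_sub, eval_add, eval_pow, eval_X, eval_mul, eval_C] at hy
      linear_combination hy
    exact ⟨.some x y ((WeierstrassCurve.Affine.equation_iff_nonsingular).mp h), rfl⟩

/-- `φ` is (the pull-back on function fields of) the Lattès map `⟨n⟩ : ℙ¹ → ℙ¹`, the map with
`π ∘ [n] = ⟨n⟩ ∘ π`. -/
def IsLattesMap (W : WeierstrassCurve ℂ) (n : ℕ) (φ : RatFunc ℂ →ₐ[ℂ] RatFunc ℂ) : Prop :=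
  open Classical in ∀ P : W.toAffine.Point, quotMap W (n • P) = pointMap φ (quotMap W P)

/-- The function field of the source of a covering `ℙ¹ → ℙ¹`, regarded as an extension of the
function field of the target by pull-back of functions. -/
def CoverField (_ : RatFunc ℂ →ₐ[ℂ] RatFunc ℂ) : Type := RatFunc ℂ

instance (φ : RatFunc ℂ →ₐ[ℂ] RatFunc ℂ) : Field (CoverField φ) :=
  inferInstanceAs (Field (RatFunc ℂ))

instance (φ : RatFunc ℂ →ₐ[ℂ] RatFunc ℂ) : Algebra (RatFunc ℂ) (CoverField φ) :=
  RingHom.toAlgebra (R := RatFunc ℂ) (S := CoverField φ) φ.toRingHom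

/-! ### Genus zero and ramification for extensions of `ℂ(t)` -/

/-- An extension of `ℂ(t)` has genus zero if it is isomorphic over `ℂ` to `ℂ(t)`. -/
def IsGenusZero (A : Type*) [CommRing A] [Algebra (RatFunc ℂ) A] : Prop :=
  ∃ e : A ≃+* RatFunc ℂ, ∀ c : ℂ, e (algebraMap (RatFunc ℂ) A (RatFunc.C c)) = RatFunc.C c

/-- The ramification index of a valuation of `L`, given by its valuation ring `w`, over `K`: the
index of the value group of the restriction to `K` in the value group. -/
def ramificationIndex (K : Type*) {L : Type*} [Field K] [Field L] [Algebra K L]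
    (w : ValuationSubring L) : ℕ :=
  ((Units.map (w.valuation : L →* w.ValueGroup)).comp
    (Units.map (algebraMap K L : K →* L))).range.index

/-- The set of valuations of `ℂ(t)` over which a finite extension `L` is ramified. A valuation of
`ℂ(t)` (trivial on `ℂ`, and not trivial) is given by its valuation ring. -/
def branchSet (L : Type*) [Field L] [Algebra (RatFunc ℂ) L] :
    Set (ValuationSubring (RatFunc ℂ)) :=
  {v | (∀ c : ℂ, RatFunc.C c ∈ v) ∧ v ≠ ⊤ ∧
    ∃ w : ValuationSubring L, w.comap (algebraMap (RatFunc ℂ) L) = v ∧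
      1 < ramificationIndex (RatFunc ℂ) w}

end Lattes

end

/-! On `x`-coordinates, `[n]` is a rational function `A n / B n`. The symmetric functions of `x(P +
Q)` and `x(P - Q)` are biquadratic in `x(P)` and `x(Q)`, which gives a recursion of order two for
coprime polynomials `A n`, `B n`. They are constructed from the multiples of the generic point,
which becomes rational over `ℂ(x)` after a quadratic twist by `f = 4x³ + b₂x² + 2b₄x + b₆`
(`exists_isMulSeq`). Induction gives degrees `n²` and `n² - 1` (`IsMulSeq.degrees`), so `⟨n⟩` has
degree `n²`.

For the tensor product, `⟨ℓm⟩` factors through `⟨ℓ⟩` and through `⟨m⟩`, so `L` and `M` embed in `N`.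
Their degrees `ℓ²` and `m²` are coprime, hence the images are linearly disjoint, and the degree
`ℓ²m²` of `N` leaves no room for more (`nonempty_tensorProduct_algEquiv`).

For the ramification, `[n]` multiplies the invariant differential by `n`. In terms of `A`, `B` this
is `f (A'B - AB')² = n² B (4A³ + b₂A²B + 2b₄AB² + b₆B³)` (`IsMulSeq.wronskian_sq`). A multiple root
of `A - bB` forces `f(b) = 0`. Conversely, if `f(b) = 0`, every simple root of `A - bB` is one of
the three roots of `f`, so for `n > 2` the degree forces a multiple root; the same holds for `B`,
the fibre over infinity. The point at infinity of the source is unramified because `deg A = deg B +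
1`. So the branch points are infinity and the three distinct roots of `f`, independently of `n`. -/

noncomputable section

namespace Lattes

open WeierstrassCurve Polynomial

/-! ### Sum and difference of points on `x`-coordinates -/

section Kummer

/-- The bihomogeneous form giving `x(P + Q) + x(P - Q)` up to the factor `(x(P) - x(Q))²`. -/
def sumForm {R : Type*} [CommRing R] (W : WeierstrassCurve R) (x₁ z₁ x₂ z₂ : R) : R :=
  2 * (x₁ * z₂ + x₂ * z₁) * (x₁ * x₂) + W.b₂ * (x₁ * x₂) * (z₁ * z₂) +
    W.b₄ * (x₁ * z₂ + x₂ * z₁) * (z₁ * z₂) + W.b₆ * (z₁ * z₂) ^ 2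

/-- The bihomogeneous form giving `x(P + Q) * x(P - Q)` up to the factor `(x(P) - x(Q))²`. -/
def prodForm {R : Type*} [CommRing R] (W : WeierstrassCurve R) (x₁ z₁ x₂ z₂ : R) : R :=
  (x₁ * x₂) ^ 2 - W.b₄ * (x₁ * x₂) * (z₁ * z₂) - W.b₆ * (x₁ * z₂ + x₂ * z₁) * (z₁ * z₂) -
    W.b₈ * (z₁ * z₂) ^ 2

theorem map_sumForm {R S : Type*} [CommRing R] [CommRing S] (W : WeierstrassCurve R) (φ : R →+* S)
    (x₁ z₁ x₂ z₂ : R) :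
    φ (sumForm W x₁ z₁ x₂ z₂) = sumForm (W.map φ) (φ x₁) (φ z₁) (φ x₂) (φ z₂) := by
  simp [sumForm, map_ofNat φ 2]

theorem map_prodForm {R S : Type*} [CommRing R] [CommRing S] (W : WeierstrassCurve R)
    (φ : R →+* S) (x₁ z₁ x₂ z₂ : R) :
    φ (prodForm W x₁ z₁ x₂ z₂) = prodForm (W.map φ) (φ x₁) (φ z₁) (φ x₂) (φ z₂) := by
  simp [prodForm]

variable {F : Type*} [Field F] {W : Affine F}

theorem sub_negY_sq {x y : F} (h : W.Equation x y) :
    (y - W.negY x y) ^ 2 = 4 * x ^ 3 + W.b₂ * x ^ 2 + 2 * W.b₄ * x + W.b₆ := by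
  rw [Affine.equation_iff] at h
  simp only [Affine.negY, WeierstrassCurve.b₂, WeierstrassCurve.b₄, WeierstrassCurve.b₆]
  linear_combination 4 * h

/-- At a point of order two the numerator of the duplication formula is the square of the
`x`-derivative of the equation. There the `y`-derivative vanishes, so nonsingularity makes the other
one nonzero. -/
theorem quartic_ne_zero_of_Y_eq {x y : F} (h : W.Nonsingular x y) (hy : y = W.negY x y) :
    x ^ 4 - W.b₄ * x ^ 2 - 2 * W.b₆ * x - W.b₈ ≠ 0 := by
  rw [Affine.nonsingular_iff] at h
  obtain ⟨h, h'⟩ := h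
  have h' := h'.resolve_right (by simpa using hy)
  rw [Affine.equation_iff] at h
  have : x ^ 4 - W.b₄ * x ^ 2 - 2 * W.b₆ * x - W.b₈ =
      (W.a₁ * y - (3 * x ^ 2 + 2 * W.a₂ * x + W.a₄)) ^ 2 := by
    simp only [Affine.negY, WeierstrassCurve.b₈, WeierstrassCurve.b₄,
      WeierstrassCurve.b₆] at hy ⊢
    grind
  rw [this]
  exact pow_ne_zero 2 (sub_ne_zero.mpr h')

/-- `(x, z)` are homogeneous coordinates of the `x`-coordinate of `P`. -/
def IsXRep (P : W.Point) (x z : F) : Prop :=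
  ∃ c : F, c ≠ 0 ∧ x = c * P.xRep 0 ∧ z = c * P.xRep 1

theorem isXRep_xRep (P : W.Point) : IsXRep P (P.xRep 0) (P.xRep 1) :=
  ⟨1, one_ne_zero, by simp, by simp⟩

/-- The three forms define a self-map of `Sym² ℙ¹ = ℙ²`, which has no base points when the
discriminant is a unit. -/
theorem forms_ne_zero [W.IsElliptic] {x₁ z₁ x₂ z₂ : F} (h₁ : x₁ ≠ 0 ∨ z₁ ≠ 0)
    (h₂ : x₂ ≠ 0 ∨ z₂ ≠ 0) (h : x₁ * z₂ - x₂ * z₁ = 0) (hs : sumForm W x₁ z₁ x₂ z₂ = 0)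
    (hp : prodForm W x₁ z₁ x₂ z₂ = 0) : False := by
  have := W.addSubMap_ne_zero (x := ![x₁ * x₂, x₁ * z₂ + x₂ * z₁, z₁ * z₂]) (by
    intro h0
    have e0 := congr_fun h0 0
    have e1 := congr_fun h0 1
    have e2 := congr_fun h0 2
    simp at e0 e1 e2
    grind)
  apply this
  ext i
  fin_cases i
  · simp [addSubMap]
    simp only [prodForm] at hp
    linear_combination hp
  · simp [addSubMap]
    simp only [sumForm] at hs
    linear_combination hs
  · simp [addSubMap]
    linear_combination (x₁ * z₂ - x₂ * z₁) * h

/-- Homogeneous coordinates of a point of the line are determined by the product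
with a second point. -/
theorem proportional_of_mul {x₃ z₃ x₃' z₃' x₄ z₄ c : F} (h₄ : x₄ ≠ 0 ∨ z₄ ≠ 0)
    (h₁ : z₃' * z₄ = c * (z₃ * z₄)) (h₂ : x₃' * z₄ + x₄ * z₃' = c * (x₃ * z₄ + x₄ * z₃))
    (h₃ : x₃' * x₄ = c * (x₃ * x₄)) : x₃' = c * x₃ ∧ z₃' = c * z₃ := by
  by_cases hz : z₄ = 0
  · subst hz
    have hx : x₄ ≠ 0 := h₄.resolve_right (by simp)
    exact ⟨mul_right_cancel₀ hx (by linear_combination h₃),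
      mul_right_cancel₀ hx (by linear_combination h₂)⟩
  · have e : z₃' = c * z₃ := mul_right_cancel₀ hz (by linear_combination h₁)
    subst e
    exact ⟨mul_right_cancel₀ hz (by linear_combination h₂), rfl⟩

variable [DecidableEq F]

theorem addX_add_addX_neg {x₁ y₁ x₂ y₂ : F} (h₁ : W.Equation x₁ y₁) (h₂ : W.Equation x₂ y₂)
    (hx : x₁ ≠ x₂) :
    (x₁ - x₂) ^ 2 * (W.addX x₁ x₂ (W.slope x₁ x₂ y₁ y₂) +
      W.addX x₁ x₂ (W.slope x₁ x₂ y₁ (W.negY x₂ y₂))) =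
      2 * (x₁ + x₂) * (x₁ * x₂) + W.b₂ * (x₁ * x₂) + W.b₄ * (x₁ + x₂) + W.b₆ := by
  have hd : x₁ - x₂ ≠ 0 := sub_ne_zero.mpr hx
  rw [Affine.slope_of_X_ne hx, Affine.slope_of_X_ne hx]
  rw [Affine.equation_iff] at h₁ h₂
  simp only [Affine.addX, Affine.negY, WeierstrassCurve.b₂, WeierstrassCurve.b₄,
    WeierstrassCurve.b₆]
  field_simp
  linear_combination 2 * h₁ + 2 * h₂

theorem addX_mul_addX_neg {x₁ y₁ x₂ y₂ : F} (h₁ : W.Equation x₁ y₁) (h₂ : W.Equation x₂ y₂)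
    (hx : x₁ ≠ x₂) :
    (x₁ - x₂) ^ 2 * (W.addX x₁ x₂ (W.slope x₁ x₂ y₁ y₂) *
      W.addX x₁ x₂ (W.slope x₁ x₂ y₁ (W.negY x₂ y₂))) =
      (x₁ * x₂) ^ 2 - W.b₄ * (x₁ * x₂) - W.b₆ * (x₁ + x₂) - W.b₈ := by
  have hd : x₁ - x₂ ≠ 0 := sub_ne_zero.mpr hx
  rw [Affine.slope_of_X_ne hx, Affine.slope_of_X_ne hx]
  rw [Affine.equation_iff] at h₁ h₂
  simp only [Affine.addX, Affine.negY, WeierstrassCurve.b₈, WeierstrassCurve.b₄,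
    WeierstrassCurve.b₆]
  field_simp
  grind

theorem sq_mul_addX_self {x y : F} (h : W.Equation x y) (hy : y ≠ W.negY x y) :
    (y - W.negY x y) ^ 2 * W.addX x x (W.slope x x y y) =
      x ^ 4 - W.b₄ * x ^ 2 - 2 * W.b₆ * x - W.b₈ := by
  have hd : y - W.negY x y ≠ 0 := sub_ne_zero.mpr hy
  rw [Affine.slope_of_Y_ne rfl hy]
  rw [Affine.equation_iff] at h
  simp only [Affine.addX, Affine.negY, WeierstrassCurve.b₈, WeierstrassCurve.b₄,
    WeierstrassCurve.b₆] at hd ⊢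
  field_simp
  grind

/-- `xRep` is normalised to `(x, 1)` or `(1, 0)`, hence the factor `c`. For points with different
`x`-coordinates it is `(x₁ - x₂)⁻²`. If `P = ±Q`, one of `P + Q`, `P - Q` is zero and the relations
reduce to the duplication formula `double`. -/
theorem xRep_add_sub (P Q : W.Point) : ∃ c : F, c ≠ 0 ∧
    (P + Q).xRep 1 * (P - Q).xRep 1 = c * (P.xRep 0 * Q.xRep 1 - Q.xRep 0 * P.xRep 1) ^ 2 ∧
    (P + Q).xRep 0 * (P - Q).xRep 1 + (P - Q).xRep 0 * (P + Q).xRep 1 =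
      c * sumForm W (P.xRep 0) (P.xRep 1) (Q.xRep 0) (Q.xRep 1) ∧
    (P + Q).xRep 0 * (P - Q).xRep 0 =
      c * prodForm W (P.xRep 0) (P.xRep 1) (Q.xRep 0) (Q.xRep 1) := by
  have double (P : W.Point) : ∃ c : F, c ≠ 0 ∧
      (P + P).xRep 0 = c * prodForm W (P.xRep 0) (P.xRep 1) (P.xRep 0) (P.xRep 1) ∧
      (P + P).xRep 1 = c * sumForm W (P.xRep 0) (P.xRep 1) (P.xRep 0) (P.xRep 1) := by
    rcases P with _ | ⟨x, y, h⟩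
    · exact ⟨1, one_ne_zero, by simp [← Affine.Point.zero_def, sumForm, prodForm]⟩
    · by_cases hy : y = W.negY x y
      · rw [Affine.Point.add_self_of_Y_eq hy]
        refine ⟨_, inv_ne_zero (quartic_ne_zero_of_Y_eq h hy), ?_, ?_⟩
        · simp only [Affine.Point.xRep_zero, Affine.Point.xRep_some, prodForm]
          rw [eq_inv_mul_iff_mul_eq₀ (quartic_ne_zero_of_Y_eq h hy)]
          simp
          ring
        · have := sub_negY_sq h.1
          rw [← hy] at this
          simp [sumForm]
          right
          linear_combination -this
      · rw [Affine.Point.add_self_of_Y_ne hy]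
        have h1 := sub_negY_sq h.1
        have h2 := sq_mul_addX_self h.1 hy
        have h0 : (y - W.negY x y) ^ 2 ≠ 0 := pow_ne_zero 2 (sub_ne_zero.mpr hy)
        refine ⟨_, inv_ne_zero h0, ?_, ?_⟩
        · rw [eq_inv_mul_iff_mul_eq₀ h0]
          simp [-Affine.addX, -Affine.negY, -Affine.slope_of_Y_ne', prodForm]
          linear_combination h2
        · rw [eq_inv_mul_iff_mul_eq₀ h0]
          simp [-Affine.negY, sumForm]
          linear_combination h1
  by_cases hPQ : P = Q
  · subst hPQ
    obtain ⟨c, hc, h1, h2⟩ := double P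
    exact ⟨c, hc, by simp, by simp [h2], by simp [h1]⟩
  by_cases hPQ' : P = -Q
  · subst hPQ'
    obtain ⟨c, hc, h1, h2⟩ := double Q
    have e : (-Q - Q).xRep = (Q + Q).xRep := by
      rw [← Affine.Point.xRep_neg]
      congr 1
      abel
    refine ⟨c, hc, ?_, ?_, ?_⟩
    · simp
    · simp [e, h2]
    · simp [e, h1]
  rcases P with _ | ⟨x₁, y₁, h₁⟩
  · refine ⟨1, one_ne_zero, ?_, ?_, ?_⟩ <;>
      simp [← Affine.Point.zero_def, sumForm, prodForm, sq]
    ring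
  rcases Q with _ | ⟨x₂, y₂, h₂⟩
  · exact ⟨1, one_ne_zero, by simp [← Affine.Point.zero_def, sumForm, prodForm, sq, two_mul]⟩
  have hx : x₁ ≠ x₂ := fun h ↦ (Affine.Point.X_eq_iff.mp h).elim hPQ hPQ'
  have hd : (x₁ - x₂) ^ 2 ≠ 0 := pow_ne_zero 2 (sub_ne_zero.mpr hx)
  have h1 := addX_add_addX_neg h₁.1 h₂.1 hx
  have h2 := addX_mul_addX_neg h₁.1 h₂.1 hx
  rw [sub_eq_add_neg, Affine.Point.neg_some, Affine.Point.add_of_X_ne hx,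
    Affine.Point.add_of_X_ne hx]
  refine ⟨_, inv_ne_zero hd, ?_, ?_, ?_⟩
  · rw [eq_inv_mul_iff_mul_eq₀ hd]
    simp
  · rw [eq_inv_mul_iff_mul_eq₀ hd]
    simp [-Affine.addX, -Affine.negY, sumForm, -Affine.slope_of_X_ne]
    linear_combination h1
  · rw [eq_inv_mul_iff_mul_eq₀ hd]
    simp [-Affine.addX, -Affine.negY, prodForm, -Affine.slope_of_X_ne]
    linear_combination h2

theorem IsXRep.add_sub {P Q : W.Point} {x₁ z₁ x₂ z₂ x₃ z₃ x₄ z₄ : F} (h₁ : IsXRep P x₁ z₁)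
    (h₂ : IsXRep Q x₂ z₂) (h₃ : IsXRep (P + Q) x₃ z₃) (h₄ : IsXRep (P - Q) x₄ z₄) :
    ∃ c : F, c ≠ 0 ∧ z₃ * z₄ = c * (x₁ * z₂ - x₂ * z₁) ^ 2 ∧
      x₃ * z₄ + x₄ * z₃ = c * sumForm W x₁ z₁ x₂ z₂ ∧ x₃ * x₄ = c * prodForm W x₁ z₁ x₂ z₂ := by
  obtain ⟨c₁, hc₁, rfl, rfl⟩ := h₁
  obtain ⟨c₂, hc₂, rfl, rfl⟩ := h₂
  obtain ⟨c₃, hc₃, rfl, rfl⟩ := h₃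
  obtain ⟨c₄, hc₄, rfl, rfl⟩ := h₄
  obtain ⟨c, hc, e₁, e₂, e₃⟩ := xRep_add_sub P Q
  -- The forms have bidegree `(2, 2)`.
  refine ⟨c * c₃ * c₄ / (c₁ * c₂) ^ 2, by positivity, ?_, ?_, ?_⟩
  · field_simp
    linear_combination e₁
  · simp only [sumForm] at *
    field_simp
    linear_combination e₂
  · simp only [prodForm] at *
    field_simp
    linear_combination e₃

end Kummer

/-! ### The derivation `d/dx` of `k(x)` -/

section RatFuncDerivation
open Polynomial

/-- The map `p ↦ p + p'ε` into the dual numbers sends nonzero polynomials to units, so it extends to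
the fraction field; its `ε`-part is the derivation. -/
theorem exists_derivation_ratFunc (k : Type*) [Field k] :
    ∃ D : Derivation k (RatFunc k) (RatFunc k),
      ∀ p : k[X], D (algebraMap k[X] (RatFunc k) p) = algebraMap k[X] (RatFunc k) p.derivative := by
  let ι := algebraMap k[X] (RatFunc k)
  let g : k[X] →ₐ[k] TrivSqZeroExt (RatFunc k) (RatFunc k) := AlgHom.ofLinearMap
    { toFun p := TrivSqZeroExt.inl (ι p) + TrivSqZeroExt.inr (ι p.derivative)
      map_add' p q := by ext <;> simp
      map_smul' c p := by
        ext <;> simp [ι, RatFunc.smul_eq_C_mul, Polynomial.smul_eq_C_mul,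
          Algebra.smul_def (_ : k[X]) (_ : RatFunc k), mul_comm] }
    (by ext <;> simp)
    (fun p q ↦ by
      ext
      · simp
      · simp
        ring)
  have hg1 (p : k[X]) : (g p).fst = ι p := by simp [g]
  have hg2 (p : k[X]) : (g p).snd = ι p.derivative := by simp [g]
  have hu (y : nonZeroDivisors k[X]) : IsUnit (g y) := by
    rw [TrivSqZeroExt.isUnit_iff_isUnit_fst, hg1]
    simp [ι]
  let G : RatFunc k →ₐ[k] TrivSqZeroExt (RatFunc k) (RatFunc k) :=
    IsLocalization.liftAlgHom (M := nonZeroDivisors k[X]) (f := g) hu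
  have hG (p : k[X]) : G (algebraMap k[X] (RatFunc k) p) = g p := by
    simp [G]
  have hfst (x : RatFunc k) : (G x).fst = x := by
    have : ((TrivSqZeroExt.fstHom k (RatFunc k) (RatFunc k)).comp G).toRingHom =
        RingHom.id _ := by
      refine IsLocalization.ringHom_ext (nonZeroDivisors k[X]) ?_
      refine RingHom.ext fun p ↦ ?_
      exact (congr_arg TrivSqZeroExt.fst (hG p)).trans (hg1 p)
    exact RingHom.congr_fun this x
  refine ⟨Derivation.mk' ((TrivSqZeroExt.sndHom (RatFunc k) (RatFunc k)).restrictScalars k ∘ₗ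
    G.toLinearMap) fun a b ↦ ?_, fun p ↦ ?_⟩
  · change (G (a * b)).snd = a * (G b).snd + b * (G a).snd
    rw [map_mul, TrivSqZeroExt.snd_mul, hfst, hfst]
    simp [mul_comm b]
  · change (G _).snd = _
    rw [hG, hg2]

end RatFuncDerivation

/-! ### Additivity of the invariant differential on a twist -/

section InvariantDifferential

variable {k K : Type*} [CommRing k] [Field K] [Algebra k K] {D : Derivation k K K} {f : K}
  {W : Affine K}

variable (D f W) in
/-- The coefficients of `y² = x³ + a₂ x² + a₄ x + a₆` are `f`, `f²`, `f³` times constants. -/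
structure IsTwist : Prop where
  a₁ : W.a₁ = 0
  a₃ : W.a₃ = 0
  a₂ : f * D W.a₂ = W.a₂ * D f
  a₄ : f * D W.a₄ = 2 * W.a₄ * D f
  a₆ : f * D W.a₆ = 3 * W.a₆ * D f

/-- Writing `x = fξ` and `y = f^(3/2) η` with `(ξ, η)` on the untwisted curve, `hx` says `Dξ / (2η)
= c / √f`: the invariant differential pulls back to `c` times a fixed form. Differentiating the
Weierstrass equation yields the matching relation for `y`. -/
theorem IsTwist.deriv_Y (hW : IsTwist D f W) {x y c : K} (h : W.Equation x y) (hy : y ≠ 0)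
    (hx : f * D x - D f * x = 2 * c * y) :
    2 * (f * D y) - 3 * D f * y = 2 * c * (3 * x ^ 2 + 2 * W.a₂ * x + W.a₄) := by
  rw [Affine.equation_iff, hW.a₁, hW.a₃] at h
  have h' := congr_arg D h
  simp only [map_add, Derivation.leibniz, Derivation.leibniz_pow, smul_eq_mul, nsmul_eq_mul] at h'
  obtain ⟨h1, h3, h2, h4, h6⟩ := hW
  apply mul_left_cancel₀ hy
  simp at h'
  linear_combination f * h' + (3 * x ^ 2 + 2 * W.a₂ * x + W.a₄) * hx + x ^ 2 * h2 + x * h4 + h6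
    - 3 * D f * h

/-- Translation invariance of the differential: the constants `c₁`, `c₂` of two points add. -/
theorem IsTwist.deriv_addX (hW : IsTwist D f W) {x₁ y₁ x₂ y₂ s c₁ c₂ : K} (hx : x₁ ≠ x₂)
    (h₁ : W.Equation x₁ y₁) (h₂ : W.Equation x₂ y₂) (hy₁ : y₁ ≠ 0) (hy₂ : y₂ ≠ 0)
    (hx₁ : f * D x₁ - D f * x₁ = 2 * c₁ * y₁) (hx₂ : f * D x₂ - D f * x₂ = 2 * c₂ * y₂)
    (hs : s * (x₁ - x₂) = y₁ - y₂) :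
    f * D (W.addX x₁ x₂ s) - D f * W.addX x₁ x₂ s = 2 * (c₁ + c₂) * W.addY x₁ x₂ y₁ s := by
  have hd : x₁ - x₂ ≠ 0 := sub_ne_zero.mpr hx
  have e₁ := hW.deriv_Y h₁ hy₁ hx₁
  have e₂ := hW.deriv_Y h₂ hy₂ hx₂
  have hs' := congr_arg D hs
  rw [Affine.equation_iff] at h₁ h₂
  obtain ⟨h1, h3, h2, h4, h6⟩ := hW
  -- The difference of the two Weierstrass equations, divided by `x₁ - x₂`: a second expression for
  -- the slope of the chord.
  have key : s * (y₁ + y₂) = x₁ ^ 2 + x₁ * x₂ + x₂ ^ 2 + W.a₂ * (x₁ + x₂) + W.a₄ := by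
    apply mul_right_cancel₀ hd
    rw [h1, h3] at h₁ h₂
    linear_combination (y₁ + y₂) * hs + h₁ - h₂
  have hσ : (2 * (f * D s) - D f * s) * (x₁ - x₂) =
      2 * (c₁ * (3 * x₁ ^ 2 + 2 * W.a₂ * x₁ + W.a₄) - c₂ * (3 * x₂ ^ 2 + 2 * W.a₂ * x₂ + W.a₄)) -
      4 * s * (c₁ * y₁ - c₂ * y₂) := by
    simp only [map_sub, Derivation.leibniz, smul_eq_mul] at hs'
    linear_combination 2 * f * hs' + e₁ - e₂ - 2 * s * (hx₁ - hx₂) - 3 * D f * hs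
  simp only [Affine.addX, Affine.addY, Affine.negAddY, Affine.negY, h1, h3, map_sub, map_add,
    Derivation.leibniz_pow, Derivation.leibniz, smul_eq_mul, nsmul_eq_mul]
  apply mul_right_cancel₀ hd
  simp [-mul_eq_mul_right_iff]
  linear_combination s * hσ - (x₁ - x₂) * h2 - (x₁ - x₂) * (hx₁ + hx₂) + 2 * s * (c₂ - c₁) * key +
    (2 * s ^ 2 * (c₁ + c₂) - 2 * (x₁ - x₂) * c₂) * hs

theorem IsTwist.deriv_addX_self (hW : IsTwist D f W) {x y s c : K}
    (h : W.Equation x y) (hy : y ≠ 0) (h2 : (2 : K) ≠ 0)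
    (hx : f * D x - D f * x = 2 * c * y)
    (hs : s * (2 * y) = 3 * x ^ 2 + 2 * W.a₂ * x + W.a₄) :
    f * D (W.addX x x s) - D f * W.addX x x s = 2 * (c + c) * W.addY x x y s := by
  have e := hW.deriv_Y h hy hx
  have hs' := congr_arg D hs
  obtain ⟨h1, h3, h2', h4, h6⟩ := hW
  have hσ : 2 * (f * D s) - D f * s = 12 * c * x + 4 * W.a₂ * c - 4 * c * s ^ 2 := by
    apply mul_left_cancel₀ (mul_ne_zero h2 hy)
    simp only [map_add, Derivation.leibniz, Derivation.leibniz_pow, smul_eq_mul,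
      nsmul_eq_mul] at hs'
    simp at hs'
    have e2 : D (2 : K) = 0 := by simpa using D.map_natCast 2
    have e3 : D (3 : K) = 0 := by simpa using D.map_natCast 3
    rw [e2, e3] at hs'
    linear_combination 2 * f * hs' - 2 * s * e + (12 * x + 4 * W.a₂) * hx + 4 * x * h2' + 2 * h4 +
      (4 * c * s - 4 * D f) * hs
  simp only [Affine.addX, Affine.addY, Affine.negAddY, Affine.negY, h1, h3, map_sub, map_add,
    Derivation.leibniz_pow, Derivation.leibniz, smul_eq_mul, nsmul_eq_mul]
  simp
  linear_combination s * hσ - h2' - 2 * hx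

end InvariantDifferential

/-! ### The generic point as a rational point of the twist -/

section GenericPoint

local notation "ι" => algebraMap ℂ[X] (RatFunc ℂ)

/-- A zero of `c` would be a common zero of the `uᵢ`, and a pole a common zero of the `vᵢ`. -/
theorem exists_const_of_proportional {u₀ u₁ u₂ v₀ v₁ v₂ : ℂ[X]} {c : RatFunc ℂ}
    (hu : ∀ r, ¬ (u₀.eval r = 0 ∧ u₁.eval r = 0 ∧ u₂.eval r = 0))
    (hv : ∀ r, ¬ (v₀.eval r = 0 ∧ v₁.eval r = 0 ∧ v₂.eval r = 0))
    (h₀ : ι u₀ = c * ι v₀) (h₁ : ι u₁ = c * ι v₁) (h₂ : ι u₂ = c * ι v₂) :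
    ∃ a : ℂ, a ≠ 0 ∧ u₀ = C a * v₀ ∧ u₁ = C a * v₁ ∧ u₂ = C a * v₂ := by
  have key {u v : ℂ[X]} (h : ι u = c * ι v) : c.denom * u = c.num * v := by
    apply RatFunc.algebraMap_injective ℂ
    rw [map_mul, map_mul, h]
    nth_rw 2 [← RatFunc.num_div_denom c]
    have := RatFunc.algebraMap_ne_zero c.denom_ne_zero
    field_simp
  have k₀ := key h₀
  have k₁ := key h₁
  have k₂ := key h₂
  obtain ⟨s, t, hst⟩ := c.isCoprime_num_denom
  have hn : c.num.degree = 0 := by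
    by_contra h
    obtain ⟨r, hr⟩ := IsAlgClosed.exists_root _ h
    rw [IsRoot.def] at hr
    have hd : c.denom.eval r ≠ 0 := fun h ↦ by simpa [hr, h] using congr_arg (eval r) hst
    apply hu r
    refine ⟨?_, ?_, ?_⟩
    · simpa [hr, hd] using congr_arg (eval r) k₀
    · simpa [hr, hd] using congr_arg (eval r) k₁
    · simpa [hr, hd] using congr_arg (eval r) k₂
  have hd : c.denom.degree = 0 := by
    by_contra h
    obtain ⟨r, hr⟩ := IsAlgClosed.exists_root _ h
    rw [IsRoot.def] at hr
    have hd : c.num.eval r ≠ 0 := fun h ↦ by simpa [hr, h] using congr_arg (eval r) hst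
    apply hv r
    refine ⟨?_, ?_, ?_⟩
    · simpa [hr, hd] using congr_arg (eval r) k₀
    · simpa [hr, hd] using congr_arg (eval r) k₁
    · simpa [hr, hd] using congr_arg (eval r) k₂
  have hd1 : c.denom = 1 := c.monic_denom.degree_le_zero_iff_eq_one.mp hd.le
  rw [hd1, one_mul, eq_C_of_degree_eq_zero hn] at k₀ k₁ k₂
  refine ⟨_, fun h ↦ ?_, k₀, k₁, k₂⟩
  rw [eq_C_of_degree_eq_zero hn, h] at hn
  simp at hn

theorem C_two : RatFunc.C (2 : ℂ) = 2 := map_ofNat _ 2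

theorem C_four : RatFunc.C (4 : ℂ) = 4 := map_ofNat _ 4

variable (W : WeierstrassCurve ℂ)

/-- The quadratic twist of `W` by the cubic `4x³ + b₂x² + 2b₄x + b₆`, over `ℂ(x)`. -/
def twist : Affine (RatFunc ℂ) where
  a₁ := 0
  a₂ := RatFunc.C (W.b₂ / 4) * ι W.Ψ₂Sq
  a₃ := 0
  a₄ := RatFunc.C (W.b₄ / 2) * ι W.Ψ₂Sq ^ 2
  a₆ := RatFunc.C (W.b₆ / 4) * ι W.Ψ₂Sq ^ 3

theorem twist_b₂ : (twist W).b₂ = RatFunc.C W.b₂ * ι W.Ψ₂Sq := by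
  simp [twist, WeierstrassCurve.b₂, C_four]
  ring

theorem twist_b₄ : (twist W).b₄ = RatFunc.C W.b₄ * ι W.Ψ₂Sq ^ 2 := by
  simp [twist, WeierstrassCurve.b₄, C_two]
  ring

theorem twist_b₆ : (twist W).b₆ = RatFunc.C W.b₆ * ι W.Ψ₂Sq ^ 3 := by
  simp [twist, WeierstrassCurve.b₆, C_four]
  ring

theorem twist_b₈ : (twist W).b₈ = RatFunc.C W.b₈ * ι W.Ψ₂Sq ^ 4 := by
  have h := congr_arg (RatFunc.C (K := ℂ)) W.b_relation
  have h4 := (twist W).b_relation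
  rw [twist_b₂, twist_b₄, twist_b₆] at h4
  simp only [map_mul, map_sub, map_pow] at h
  rw [C_four] at h
  apply mul_left_cancel₀ (show (4 : RatFunc ℂ) ≠ 0 by norm_num)
  linear_combination h4 - ι W.Ψ₂Sq ^ 4 * h

theorem sumForm_twist (x₁ z₁ x₂ z₂ : RatFunc ℂ) :
    sumForm (twist W) (ι W.Ψ₂Sq * x₁) z₁ (ι W.Ψ₂Sq * x₂) z₂ =
      ι W.Ψ₂Sq ^ 3 * sumForm (W.map RatFunc.C) x₁ z₁ x₂ z₂ := by
  simp only [sumForm, twist_b₂, twist_b₄, twist_b₆, map_b₂, map_b₄, map_b₆]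
  ring

theorem prodForm_twist (x₁ z₁ x₂ z₂ : RatFunc ℂ) :
    prodForm (twist W) (ι W.Ψ₂Sq * x₁) z₁ (ι W.Ψ₂Sq * x₂) z₂ =
      ι W.Ψ₂Sq ^ 4 * prodForm (W.map RatFunc.C) x₁ z₁ x₂ z₂ := by
  simp only [prodForm, twist_b₈, twist_b₄, twist_b₆, map_b₈, map_b₄, map_b₆]
  ring

theorem natDegree_cubic : W.Ψ₂Sq.natDegree = 3 := W.natDegree_Ψ₂Sq (by norm_num)

theorem cubic_ne_zero : ι W.Ψ₂Sq ≠ 0 :=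
  RatFunc.algebraMap_ne_zero (W.Ψ₂Sq_ne_zero (by norm_num))

/-- On the model `η² = f/4` the generic point has `η = √f / 2`. The twist multiplies `η` by
`f^(3/2)`, which gives `f² / 2`. -/
theorem nonsingular_generic :
    (twist W).Nonsingular (ι W.Ψ₂Sq * RatFunc.X) (ι W.Ψ₂Sq ^ 2 / 2) := by
  have hf := cubic_ne_zero W
  have hx : ι W.Ψ₂Sq = 4 * RatFunc.X ^ 3 + RatFunc.C W.b₂ * RatFunc.X ^ 2 +
      2 * RatFunc.C W.b₄ * RatFunc.X + RatFunc.C W.b₆ := by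
    simp [Ψ₂Sq, C_four, C_two]
  rw [Affine.nonsingular_iff, Affine.equation_iff]
  constructor
  · simp only [twist, map_div₀]
    rw [C_four, C_two]
    linear_combination ι W.Ψ₂Sq ^ 3 / 4 * hx
  · right
    simp only [twist]
    intro h
    apply hf
    have : ι W.Ψ₂Sq ^ 2 = 0 := by linear_combination h
    simpa using this

/-- The point of the twist which corresponds to the generic point of `W`. -/
def genericPoint : (twist W).Point := .some _ _ (nonsingular_generic W)

variable {W} in
/-- `P` has `x`-coordinate `A / B` in lowest terms, up to the twist. -/
def IsXPair (P : (twist W).Point) (A B : ℂ[X]) : Prop :=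
  IsCoprime A B ∧ IsXRep P (ι W.Ψ₂Sq * ι A) (ι B)

theorem isXPair_zero : IsXPair (0 : (twist W).Point) 1 0 :=
  ⟨isCoprime_one_left, ι W.Ψ₂Sq, cubic_ne_zero W, by simp, by simp⟩

theorem isXPair_generic : IsXPair (genericPoint W) X 1 :=
  ⟨isCoprime_one_right, 1, one_ne_zero, by simp [genericPoint], by simp [genericPoint]⟩

variable {W}

theorem exists_isXPair (P : (twist W).Point) : ∃ A B, IsXPair P A B := by
  rcases P with _ | ⟨x, y, h⟩
  · exact ⟨1, 0, isXPair_zero W⟩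
  · have hd := RatFunc.algebraMap_ne_zero (x / ι W.Ψ₂Sq).denom_ne_zero
    refine ⟨(x / ι W.Ψ₂Sq).num, (x / ι W.Ψ₂Sq).denom, RatFunc.isCoprime_num_denom _,
      ι (x / ι W.Ψ₂Sq).denom, hd, ?_, by simp⟩
    have := RatFunc.num_div_denom (x / ι W.Ψ₂Sq)
    have hf := cubic_ne_zero W
    rw [div_eq_div_iff hd hf] at this
    simp
    linear_combination this

theorem eval_ne_zero_of_isCoprime {A B : ℂ[X]} (h : IsCoprime A B) (r : ℂ) :
    A.eval r ≠ 0 ∨ B.eval r ≠ 0 := by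
  obtain ⟨s, t, hst⟩ := h
  by_contra! h
  simpa [h] using congr_arg (eval r) hst

/-- A priori the relations hold up to a factor in `ℂ(x)`. The left sides have no common zero by
coprimality, the right sides none by `forms_ne_zero`, so the factor is a constant and can be
absorbed into `(A₃, B₃)`. -/
theorem IsXPair.add_generic [W.IsElliptic] [DecidableEq (RatFunc ℂ)] {P : (twist W).Point}
    {A₁ B₁ A₄ B₄ : ℂ[X]} (h₁ : IsXPair P A₁ B₁) (h₄ : IsXPair (P - genericPoint W) A₄ B₄) :
    ∃ A₃ B₃, IsXPair (P + genericPoint W) A₃ B₃ ∧ B₃ * B₄ = (A₁ - X * B₁) ^ 2 ∧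
      A₃ * B₄ + A₄ * B₃ = sumForm (W.map C) A₁ B₁ X 1 ∧
      A₃ * A₄ = prodForm (W.map C) A₁ B₁ X 1 := by
  obtain ⟨A₃, B₃, h₃⟩ := exists_isXPair (P + genericPoint W)
  obtain ⟨c, hc, e₁, e₂, e₃⟩ := h₁.2.add_sub (isXPair_generic W).2 h₃.2 h₄.2
  have hf := cubic_ne_zero W
  rw [sumForm_twist] at e₂
  rw [prodForm_twist] at e₃
  have hmap : W.map RatFunc.C = (W.map (C : ℂ →+* ℂ[X])).map ι := by
    rw [WeierstrassCurve.map_map]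
    rfl
  rw [hmap, ← map_sumForm] at e₂
  rw [hmap, ← map_prodForm] at e₃
  have hmap' (r : ℂ) : (W.map (C : ℂ →+* ℂ[X])).map (evalRingHom r) = W := by
    rw [WeierstrassCurve.map_map]
    convert W.map_id
    ext
    simp
  obtain ⟨a, ha, k₁, k₂, k₃⟩ := exists_const_of_proportional (c := c * ι W.Ψ₂Sq ^ 2)
    (u₀ := B₃ * B₄) (u₁ := A₃ * B₄ + A₄ * B₃) (u₂ := A₃ * A₄)
    (v₀ := (A₁ - X * B₁) ^ 2) (v₁ := sumForm (W.map C) A₁ B₁ X 1)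
    (v₂ := prodForm (W.map C) A₁ B₁ X 1) (by
      intro r
      have := eval_ne_zero_of_isCoprime h₃.1 r
      have := eval_ne_zero_of_isCoprime h₄.1 r
      simp only [eval_mul, eval_add]
      grind) (by
      rintro r ⟨g₁, g₂, g₃⟩
      rw [← coe_evalRingHom] at g₂ g₃
      rw [map_sumForm, hmap'] at g₂
      rw [map_prodForm, hmap'] at g₃
      refine forms_ne_zero (eval_ne_zero_of_isCoprime h₁.1 r)
        (eval_ne_zero_of_isCoprime isCoprime_one_right r) ?_ g₂ g₃
      simp at g₁ ⊢
      exact g₁)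
    (by simp only [map_mul, map_pow, map_sub, RatFunc.algebraMap_X, map_one] at e₁ ⊢
        linear_combination e₁)
    (by apply mul_left_cancel₀ hf
        simp only [map_mul, map_add] at e₂ ⊢
        linear_combination e₂)
    (by apply mul_left_cancel₀ (pow_ne_zero 2 hf)
        simp only [map_mul] at e₃ ⊢
        linear_combination e₃)
  have hCa : (C a : ℂ[X]) * C a⁻¹ = 1 := by rw [← C_mul, mul_inv_cancel₀ ha, C_1]
  have hCa0 : ι (C a⁻¹) ≠ 0 := RatFunc.algebraMap_ne_zero (by simpa using ha)
  have hu : IsUnit (C a⁻¹ : ℂ[X]) := isUnit_C.mpr (by simpa using ha)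
  refine ⟨C a⁻¹ * A₃, C a⁻¹ * B₃, ⟨?_, ?_⟩, ?_, ?_, ?_⟩
  · exact (isCoprime_mul_unit_left hu _ _).mpr h₃.1
  · obtain ⟨c, hc, e, e'⟩ := h₃.2
    refine ⟨ι (C a⁻¹) * c, mul_ne_zero hCa0 hc, ?_, ?_⟩
    · rw [map_mul]
      linear_combination ι (C a⁻¹) * e
    · rw [map_mul]
      linear_combination ι (C a⁻¹) * e'
  · linear_combination C a⁻¹ * k₁ + (A₁ - X * B₁) ^ 2 * hCa
  · linear_combination C a⁻¹ * k₂ + sumForm (W.map C) A₁ B₁ X 1 * hCa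
  · linear_combination C a⁻¹ * k₃ + prodForm (W.map C) A₁ B₁ X 1 * hCa

end GenericPoint

/-! ### The polynomials `A n`, `B n` and their degrees -/

section Sequence

/-- `A n / B n` is the rational function giving the `x`-coordinate of `n • P` in terms of the
`x`-coordinate of `P`. -/
structure IsMulSeq (W : WeierstrassCurve ℂ) (A B : ℕ → ℂ[X]) : Prop where
  A_zero : A 0 = 1
  B_zero : B 0 = 0
  A_one : A 1 = X
  B_one : B 1 = 1
  coprime (n : ℕ) : IsCoprime (A n) (B n)
  sq (n : ℕ) : B (n + 2) * B n = (A (n + 1) - X * B (n + 1)) ^ 2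
  add (n : ℕ) : A (n + 2) * B n + A n * B (n + 2) =
    sumForm (W.map C) (A (n + 1)) (B (n + 1)) X 1
  mul (n : ℕ) : A (n + 2) * A n = prodForm (W.map C) (A (n + 1)) (B (n + 1)) X 1
  isXRep [DecidableEq (RatFunc ℂ)] (n : ℕ) : IsXPair (n • genericPoint W) (A n) (B n)

theorem exists_isMulSeq (W : WeierstrassCurve ℂ) [W.IsElliptic] : ∃ A B, IsMulSeq W A B := by
  classical
  -- The recursion has order two, so the state records coprime pairs for two consecutive multiples.
  let T := {s : ℕ × (ℂ[X] × ℂ[X]) × (ℂ[X] × ℂ[X]) //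
    IsXPair (s.1 • genericPoint W) s.2.1.1 s.2.1.2 ∧
    IsXPair ((s.1 + 1) • genericPoint W) s.2.2.1 s.2.2.2}
  have step (t : T) : ∃ t' : T, t'.1.1 = t.1.1 + 1 ∧ t'.1.2.1 = t.1.2.2 ∧
      t'.1.2.2.2 * t.1.2.1.2 = (t.1.2.2.1 - X * t.1.2.2.2) ^ 2 ∧
      t'.1.2.2.1 * t.1.2.1.2 + t.1.2.1.1 * t'.1.2.2.2 =
        sumForm (W.map C) t.1.2.2.1 t.1.2.2.2 X 1 ∧
      t'.1.2.2.1 * t.1.2.1.1 = prodForm (W.map C) t.1.2.2.1 t.1.2.2.2 X 1 := by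
    obtain ⟨⟨n, ⟨A, B⟩, ⟨A', B'⟩⟩, h, h'⟩ := t
    dsimp only at h h'
    obtain ⟨A₃, B₃, k, k₁, k₂, k₃⟩ := h'.add_generic (A₄ := A) (B₄ := B) (by
      rwa [succ_nsmul, add_sub_cancel_right])
    refine ⟨⟨⟨n + 1, ⟨A', B'⟩, ⟨A₃, B₃⟩⟩, h', ?_⟩, rfl, rfl, k₁, k₂, k₃⟩
    rwa [succ_nsmul _ (n + 1)]
  choose next h₁ h₂ h₃ h₄ h₅ using step
  let t₀ : T := ⟨⟨0, ⟨1, 0⟩, ⟨X, 1⟩⟩, by simpa using isXPair_zero W, by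
    simpa only [zero_add, one_nsmul] using isXPair_generic W⟩
  let s : ℕ → T := fun n ↦ next^[n] t₀
  have hs (n : ℕ) : s (n + 1) = next (s n) := Function.iterate_succ_apply' _ _ _
  have hn (n : ℕ) : (s n).1.1 = n := by
    induction n with
    | zero => rfl
    | succ n ih => rw [hs, h₁, ih]
  have hs' (n : ℕ) : (s (n + 1)).1.2.1 = (s n).1.2.2 := by rw [hs, h₂]
  have hp (n : ℕ) : IsXPair (n • genericPoint W) (s n).1.2.1.1 (s n).1.2.1.2 := by
    have := (s n).2.1
    rwa [hn] at this
  refine ⟨fun n ↦ (s n).1.2.1.1, fun n ↦ (s n).1.2.1.2, rfl, rfl, ?_, ?_, fun n ↦ (hp n).1,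
    fun n ↦ ?_, fun n ↦ ?_, fun n ↦ ?_, fun n ↦ ?_⟩
  · rw [hs']
    rfl
  · rw [hs']
    rfl
  · simp only [hs' (n + 1), hs' n]
    rw [hs, h₃]
  · simp only [hs' (n + 1), hs' n]
    rw [hs, h₄]
  · simp only [hs' (n + 1), hs' n]
    rw [hs, h₅]
  · convert hp n

variable {W : WeierstrassCurve ℂ} {A B : ℕ → ℂ[X]}

/-- Compare leading terms in the recursion: the product relation determines `A`, the square relation
determines `B`. -/
theorem IsMulSeq.degrees (h : IsMulSeq W A B) (n : ℕ) :
    (A (n + 1)).Monic ∧ (A (n + 1)).natDegree = (n + 1) ^ 2 ∧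
      (B (n + 1)).natDegree = (n + 1) ^ 2 - 1 ∧ (B (n + 1)).leadingCoeff = (n + 1) ^ 2 := by
  induction n using Nat.strong_induction_on with
  | _ n ih =>
  match n with
  | 0 => simp [h.A_one, h.B_one]
  -- As `B 0 = 0`, the square relation says nothing about `B 2`; it is read off from the sum
  -- relation instead.
  | 1 =>
    have h₁ := h.add 0
    have h₂ := h.mul 0
    simp only [h.A_zero, h.B_zero, h.A_one, h.B_one, zero_add, mul_zero, mul_one, one_mul] at h₁ h₂
    have hB : B 2 = W.Ψ₂Sq := by
      rw [h₁]
      simp [sumForm, Ψ₂Sq, map_ofNat C]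
      ring
    have hA : A 2 = X ^ 4 - (C W.b₄ * X ^ 2 + C (2 * W.b₆) * X + C W.b₈) := by
      rw [h₂]
      simp [prodForm, map_ofNat C]
      ring
    have hd : (C W.b₄ * X ^ 2 + C (2 * W.b₆) * X + C W.b₈).degree < 4 :=
      (degree_quadratic_le).trans_lt (by norm_num)
    refine ⟨?_, ?_, ?_, ?_⟩
    · rw [hA]
      exact monic_X_pow_sub (n := 4) hd
    · rw [hA]
      exact natDegree_eq_of_degree_eq_some
        ((degree_sub_eq_left_of_degree_lt (by rwa [degree_X_pow])).trans (degree_X_pow 4))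
    · rw [hB, natDegree_cubic]
      norm_num
    · rw [hB, W.leadingCoeff_Ψ₂Sq (by norm_num)]
      norm_num
  | n + 2 =>
    obtain ⟨m₁, a₁, b₁, l₁⟩ := ih n (by omega)
    obtain ⟨m₂, a₂, b₂, l₂⟩ := ih (n + 1) (by omega)
    have hB := h.sq (n + 1)
    have hA := h.mul (n + 1)
    have hN : 1 ≤ (n + 1 + 1) ^ 2 := Nat.one_le_pow _ _ (by omega)
    set N := (n + 1 + 1) ^ 2 with hN'
    set P := A (n + 1 + 1)
    set Q := B (n + 1 + 1)
    have hPX : ((P * X) ^ 2).Monic := (m₂.mul monic_X).pow 2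
    have dPX : ((P * X) ^ 2).natDegree = 2 * (N + 1) := by
      rw [(m₂.mul monic_X).natDegree_pow, m₂.natDegree_mul monic_X, a₂, natDegree_X]
    have hA' : prodForm (W.map C) P Q X 1 = (P * X) ^ 2 -
        (C W.b₄ * (P * X * Q) + C W.b₆ * ((P + X * Q) * Q) + C W.b₈ * Q ^ 2) := by
      simp [prodForm]
      ring
    have hR : (C W.b₄ * (P * X * Q) + C W.b₆ * ((P + X * Q) * Q) + C W.b₈ * Q ^ 2).natDegree <
        2 * (N + 1) := by
      have hXQ : (X * Q).natDegree ≤ N :=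
        (natDegree_mul_le_of_le natDegree_X_le b₂.le).trans (by omega)
      refine Nat.lt_succ_of_le (m := 2 * N + 1) ?_
      refine natDegree_add_le_of_degree_le (natDegree_add_le_of_degree_le ?_ ?_) ?_
      · refine (natDegree_C_mul_le _ _).trans ?_
        rw [mul_assoc]
        exact (natDegree_mul_le_of_le a₂.le hXQ).trans (by omega)
      · refine (natDegree_C_mul_le _ _).trans ?_
        exact (natDegree_mul_le_of_le (natDegree_add_le_of_degree_le a₂.le hXQ) b₂.le).trans
          (by omega)
      · refine (natDegree_C_mul_le _ _).trans ?_
        exact (natDegree_pow_le_of_le 2 b₂.le).trans (by omega)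
    have hm : (A (n + 1 + 2) * A (n + 1)).Monic := by
      rw [hA, hA']
      exact hPX.sub_of_left (degree_lt_degree (by rwa [dPX]))
    have hd : (A (n + 1 + 2) * A (n + 1)).natDegree = 2 * (N + 1) := by
      rw [hA, hA', natDegree_sub_eq_left_of_natDegree_lt (by rwa [dPX]), dPX]
    have hm' : (A (n + 1 + 2)).Monic := m₁.of_mul_monic_right hm
    rw [hm'.natDegree_mul m₁, a₁] at hd
    -- Up to sign this is `(n + 1)(n + 3)`. Dividing its square by the leading coefficient `(n +
    -- 1)²` of `B (n + 1)` leaves `(n + 3)²`.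
    have hcoeff : (P - X * Q).coeff N = 1 - ((n : ℂ) + 2) ^ 2 := by
      have h1 : P.coeff N = 1 := by
        rw [← a₂]
        exact m₂.coeff_natDegree
      have h2 : (X * Q).coeff N = ((n : ℂ) + 2) ^ 2 := by
        obtain ⟨M, hM⟩ := Nat.exists_eq_add_of_le' hN
        rw [hM, coeff_X_mul, show M = Q.natDegree by omega, coeff_natDegree, l₂]
        push_cast
        ring
      rw [coeff_sub, h1, h2]
    have hc0 : (1 : ℂ) - (n + 2) ^ 2 ≠ 0 := by
      have : (1 : ℂ) - (n + 2) ^ 2 = -(((n + 1) * (n + 3) : ℕ) : ℂ) := by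
        push_cast
        ring
      rw [this, neg_ne_zero, Nat.cast_ne_zero]
      positivity
    have hD : (P - X * Q).natDegree = N := by
      refine natDegree_eq_of_le_of_coeff_ne_zero ?_ (by rwa [hcoeff])
      exact (natDegree_sub_le_of_le a₂.le
        ((natDegree_mul_le_of_le natDegree_X_le b₂.le).trans (by omega))).trans_eq (max_self N)
    have hDl : (P - X * Q).leadingCoeff = 1 - ((n : ℂ) + 2) ^ 2 := by
      rw [leadingCoeff, hD, hcoeff]
    have hD0 : (P - X * Q) ^ 2 ≠ 0 := by
      refine pow_ne_zero 2 fun h0 ↦ hc0 ?_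
      rw [← hDl, h0, leadingCoeff_zero]
    have hB0 : B (n + 1 + 2) ≠ 0 ∧ B (n + 1) ≠ 0 := by
      rw [← hB] at hD0
      exact ⟨left_ne_zero_of_mul hD0, right_ne_zero_of_mul hD0⟩
    have hBd := congr_arg natDegree hB
    have hBl := congr_arg leadingCoeff hB
    rw [natDegree_mul hB0.1 hB0.2, natDegree_pow, hD, b₁] at hBd
    rw [leadingCoeff_mul, leadingCoeff_pow, hDl, l₁] at hBl
    refine ⟨hm', ?_, ?_, ?_⟩
    · change (A (n + 1 + 2)).natDegree = _
      rw [hN'] at hd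
      ring_nf at hd ⊢
      omega
    · change (B (n + 1 + 2)).natDegree = _
      have : 1 ≤ (n + 1) ^ 2 := Nat.one_le_pow _ _ (by omega)
      have e : (n + 2 + 1) ^ 2 + (n + 1) ^ 2 = 2 * N + 2 := by
        rw [hN']
        ring
      omega
    · change (B (n + 1 + 2)).leadingCoeff = _
      have : ((n : ℂ) + 1) ^ 2 ≠ 0 := pow_ne_zero 2 (Nat.cast_add_one_ne_zero n)
      apply mul_right_cancel₀ this
      rw [hBl]
      push_cast
      ring

/-- The recursion specialises to every point, torsion included: it prescribes the product of two
linear forms, and the one of index `n` is nonzero by coprimality, so it can be cancelled even where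
a multiple of the point vanishes. -/
theorem IsMulSeq.isXRep_nsmul [DecidableEq ℂ] [W.IsElliptic] (h : IsMulSeq W A B)
    {x y : ℂ} (hxy : W.toAffine.Nonsingular x y) (n : ℕ) :
    IsXRep (n • Affine.Point.some x y hxy) ((A n).eval x) ((B n).eval x) := by
  have hmap : (W.map (C : ℂ →+* ℂ[X])).map (evalRingHom x) = W := by
    rw [WeierstrassCurve.map_map]
    convert W.map_id
    ext
    simp
  induction n using Nat.strong_induction_on with
  | _ n ih =>
  match n with
  | 0 => exact ⟨1, one_ne_zero, by simp [h.A_zero], by simp [h.B_zero]⟩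
  | 1 => exact ⟨1, one_ne_zero, by simp [h.A_one], by simp [h.B_one]⟩
  | n + 2 =>
    set P := Affine.Point.some x y hxy with hP
    have i₁ := ih n (by omega)
    have i₂ := ih (n + 1) (by omega)
    have i₃ : IsXRep P x 1 := ⟨1, one_ne_zero, by simp [hP], by simp [hP]⟩
    have e₁ := congr_arg (evalRingHom x) (h.sq n)
    have e₂ := congr_arg (evalRingHom x) (h.add n)
    have e₃ := congr_arg (evalRingHom x) (h.mul n)
    rw [map_sumForm, hmap] at e₂
    rw [map_prodForm, hmap] at e₃
    simp at e₁ e₂ e₃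
    obtain ⟨c, hc, k₁, k₂, k₃⟩ := i₂.add_sub i₃ (isXRep_xRep ((n + 1) • P + P))
      (x₄ := (A n).eval x) (z₄ := (B n).eval x) (by
        rwa [succ_nsmul, add_sub_cancel_right])
    rw [succ_nsmul _ (n + 1)]
    obtain ⟨r₁, r₂⟩ := proportional_of_mul (eval_ne_zero_of_isCoprime (h.coprime n) x)
      (x₃' := (A (n + 2)).eval x) (z₃' := (B (n + 2)).eval x) (c := c⁻¹)
      (by rw [k₁, e₁]; field_simp) (by rw [k₂, e₂]; field_simp) (by rw [k₃, e₃]; field_simp)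
    exact ⟨c⁻¹, inv_ne_zero hc, r₁, r₂⟩

end Sequence

/-! ### The differential equation of the Lattès maps -/

section DifferentialEquation

local notation "ι" => algebraMap ℂ[X] (RatFunc ℂ)

variable {W : WeierstrassCurve ℂ} {A B : ℕ → ℂ[X]}

theorem IsMulSeq.B_ne_zero (h : IsMulSeq W A B) (n : ℕ) : B (n + 1) ≠ 0 := by
  intro h0
  have := (h.degrees n).2.2.2
  rw [h0, leadingCoeff_zero] at this
  exact pow_ne_zero 2 (Nat.cast_add_one_ne_zero n) this.symm

theorem isTwist (W : WeierstrassCurve ℂ) (D : Derivation ℂ (RatFunc ℂ) (RatFunc ℂ)) :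
    IsTwist D (ι W.Ψ₂Sq) (twist W) := by
  have hC (c : ℂ) : D (RatFunc.C c) = 0 := D.map_algebraMap c
  refine ⟨rfl, rfl, ?_, ?_, ?_⟩
  · simp [twist, hC, -map_div₀]
    ring
  · simp [twist, hC, -map_div₀]
    ring
  · simp [twist, hC, -map_div₀]
    ring

/-- Since `B (n + 1) ≠ 0`, the generic point has infinite order. Applied to the double of the
multiple, this also excludes `y = 0`. -/
theorem IsMulSeq.nsmul_eq_some [DecidableEq (RatFunc ℂ)] (h : IsMulSeq W A B) (n : ℕ) :
    ∃ x y hxy, (n + 1) • genericPoint W = .some x y hxy ∧ y ≠ 0 ∧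
      x * ι (B (n + 1)) = ι W.Ψ₂Sq * ι (A (n + 1)) := by
  have hP (m : ℕ) : (m + 1) • genericPoint W ≠ 0 := by
    intro h0
    obtain ⟨-, c, hc, -, e⟩ := h.isXRep (m + 1)
    rw [h0] at e
    exact RatFunc.algebraMap_ne_zero (h.B_ne_zero m) (by simpa using e)
  obtain ⟨-, c, hc, e, e'⟩ := h.isXRep (n + 1)
  have h2 := hP (n + 1 + n)
  rw [show n + 1 + n + 1 = (n + 1) + (n + 1) by ring, add_nsmul] at h2
  have h1 := hP n
  rcases hQ : (n + 1) • genericPoint W with _ | ⟨x, y, hxy⟩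
  · exact absurd hQ h1
  · refine ⟨x, y, hxy, rfl, ?_, ?_⟩
    · rintro rfl
      rw [hQ] at h2
      exact h2 (Affine.Point.add_self_of_Y_eq (by simp [twist]))
    · rw [e, e', hQ]
      simp
      ring

/-- The pull-back of the invariant differential by `[n + 1]` is `n + 1` times it: the generic point
has constant `1`, and constants add. -/
theorem IsMulSeq.deriv_x [DecidableEq (RatFunc ℂ)] (h : IsMulSeq W A B)
    {D : Derivation ℂ (RatFunc ℂ) (RatFunc ℂ)} (hD : ∀ p, D (ι p) = ι (derivative p))
    (n : ℕ) {x y : RatFunc ℂ} {hxy : (twist W).Nonsingular x y}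
    (hP : (n + 1) • genericPoint W = .some x y hxy) :
    ι W.Ψ₂Sq * D x - D (ι W.Ψ₂Sq) * x = 2 * (n + 1) * y := by
  have hf := cubic_ne_zero W
  have hg : ι W.Ψ₂Sq * D (ι W.Ψ₂Sq * RatFunc.X) - D (ι W.Ψ₂Sq) * (ι W.Ψ₂Sq * RatFunc.X) =
      2 * 1 * (ι W.Ψ₂Sq ^ 2 / 2) := by
    have : D RatFunc.X = 1 := by rw [← RatFunc.algebraMap_X, hD]; simp
    rw [D.leibniz, this]
    simp
    ring
  induction n generalizing x y with
  | zero =>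
    rw [zero_add, one_nsmul, genericPoint, Affine.Point.some.injEq] at hP
    obtain ⟨rfl, rfl⟩ := hP
    simpa using hg
  | succ n ih =>
    obtain ⟨x', y', hxy', hP', hy', hx'⟩ := h.nsmul_eq_some n
    have hi := ih hP'
    have hy0 : ι W.Ψ₂Sq ^ 2 / 2 ≠ 0 := div_ne_zero (pow_ne_zero 2 hf) two_ne_zero
    rw [succ_nsmul, hP'] at hP
    match n with
    | 0 =>
      rw [zero_add, one_nsmul] at hP'
      rw [hP', Affine.Point.add_self_of_Y_ne (by
        simp only [twist, Affine.negY]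
        intro h0
        exact hy' (by linear_combination h0 / 2)), Affine.Point.some.injEq] at hP
      obtain ⟨rfl, rfl⟩ := hP
      have hne : y' ≠ (twist W).negY x' y' := by
        simp only [twist, Affine.negY]
        intro h0
        exact hy' (by linear_combination h0 / 2)
      have := (isTwist W D).deriv_addX_self hxy'.1 hy' two_ne_zero hi
        (s := (twist W).slope x' x' y' y') (by
          rw [Affine.slope_of_Y_ne rfl hne]
          simp only [Affine.negY, (isTwist W D).a₁, (isTwist W D).a₃]
          rw [show y' - (-y' - 0 * x' - 0) = 2 * y' by ring,
            div_mul_cancel₀ _ (mul_ne_zero two_ne_zero hy')]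
          ring)
      rw [this]
      push_cast
      ring
    | n + 1 =>
      -- Equality would equate the leading coefficients `1` of `A (n + 2)` and `(n + 2)²` of `X * B
      -- (n + 2)`.
      have hne : x' ≠ ι W.Ψ₂Sq * RatFunc.X := by
        rintro rfl
        have e : ι (A (n + 1 + 1)) = ι (X * B (n + 1 + 1)) := by
          apply mul_left_cancel₀ hf
          rw [← hx', map_mul, RatFunc.algebraMap_X]
          ring
        have e' := congr_arg leadingCoeff (RatFunc.algebraMap_injective ℂ e)
        rw [leadingCoeff_mul, leadingCoeff_X, (h.degrees (n + 1)).1.leadingCoeff,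
          (h.degrees (n + 1)).2.2.2, one_mul] at e'
        have e'' : (1 : ℕ) = (n + 1 + 1) ^ 2 := by exact_mod_cast e'
        exact (Nat.one_lt_pow two_ne_zero (show 1 < n + 1 + 1 by omega)).ne e''
      rw [genericPoint, Affine.Point.add_of_X_ne hne, Affine.Point.some.injEq] at hP
      obtain ⟨rfl, rfl⟩ := hP
      have := (isTwist W D).deriv_addX hne hxy'.1 (nonsingular_generic W).1 hy' hy0 hi hg
        (s := (twist W).slope x' (ι W.Ψ₂Sq * RatFunc.X) y' (ι W.Ψ₂Sq ^ 2 / 2)) (by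
          rw [Affine.slope_of_X_ne hne]
          exact div_mul_cancel₀ _ (sub_ne_zero.mpr hne))
      rw [this]
      push_cast
      ring

/-- The differential equation of the Lattès maps: `[n]` multiplies the invariant differential
by `n`. -/
theorem IsMulSeq.wronskian_sq (h : IsMulSeq W A B) (n : ℕ) :
    W.Ψ₂Sq * (derivative (A (n + 1)) * B (n + 1) - A (n + 1) * derivative (B (n + 1))) ^ 2 =
      C (((n : ℂ) + 1) ^ 2) * B (n + 1) * (C 4 * A (n + 1) ^ 3 + C W.b₂ * A (n + 1) ^ 2 * B (n + 1) +
        C (2 * W.b₄) * A (n + 1) * B (n + 1) ^ 2 + C W.b₆ * B (n + 1) ^ 3) := by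
  classical
  obtain ⟨D, hD⟩ := exists_derivation_ratFunc ℂ
  obtain ⟨x, y, hxy, hP, -, hx⟩ := h.nsmul_eq_some n
  have hd := h.deriv_x hD n hP
  have hB := RatFunc.algebraMap_ne_zero (h.B_ne_zero n)
  have hf := cubic_ne_zero W
  generalize A (n + 1) = a at *
  generalize B (n + 1) = b at *
  have hDx := congr_arg D hx
  simp only [D.leibniz, hD, smul_eq_mul] at hDx hd
  have heq := hxy.1
  rw [Affine.equation_iff] at heq
  simp only [twist, map_div₀, C_four, C_two] at heq
  apply RatFunc.algebraMap_injective ℂ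
  simp only [map_mul, map_pow, map_sub, map_add, RatFunc.algebraMap_C, C_four, C_two, map_natCast,
    map_one]
  -- The quotient rule for `x = f a / b` turns `hd` into a formula for the Wronskian. Squaring it
  -- and inserting the equation of the twist eliminates `y`.
  have key : ι W.Ψ₂Sq ^ 2 * (ι (derivative a) * ι b - ι a * ι (derivative b)) =
      2 * (n + 1) * y * ι b ^ 2 := by
    linear_combination ι b ^ 2 * hd - ι W.Ψ₂Sq * ι b * hDx + (ι (derivative W.Ψ₂Sq) * ι b +
      ι W.Ψ₂Sq * ι (derivative b)) * hx
  apply mul_left_cancel₀ (pow_ne_zero 3 hf)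
  have h4 : 4 * y ^ 2 * ι b ^ 3 = ι W.Ψ₂Sq ^ 3 * (4 * ι a ^ 3 + RatFunc.C W.b₂ * ι a ^ 2 * ι b +
      2 * RatFunc.C W.b₄ * ι a * ι b ^ 2 + RatFunc.C W.b₆ * ι b ^ 3) := by
    linear_combination 4 * ι b ^ 3 * heq + (4 * (x ^ 2 * ι b ^ 2 + x * ι b * ι W.Ψ₂Sq * ι a +
      ι W.Ψ₂Sq ^ 2 * ι a ^ 2) + RatFunc.C W.b₂ * ι W.Ψ₂Sq * ι b * (x * ι b + ι W.Ψ₂Sq * ι a) +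
      2 * RatFunc.C W.b₄ * ι W.Ψ₂Sq ^ 2 * ι b ^ 2) * hx
  linear_combination (ι W.Ψ₂Sq ^ 2 * (ι (derivative a) * ι b - ι a * ι (derivative b)) +
      2 * (n + 1) * y * ι b ^ 2) * key + (n + 1) ^ 2 * ι b * h4

end DifferentialEquation

/-! ### Existence, uniqueness and degree of the Lattès map -/

section LattesMap

local notation "ι" => algebraMap ℂ[X] (RatFunc ℂ)

theorem ratio_mul {c : ℂ} (hc : c ≠ 0) (a b : ℂ) : ratio (c * a) (c * b) = ratio a b := by
  by_cases hb : b = 0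
  · simp [ratio, hb]
  · simp [ratio, hb, hc, mul_div_mul_left]

theorem cross_mul_of_ratio_eq {a b a' b' : ℂ} (h : ratio a b = ratio a' b') : a * b' = a' * b := by
  by_cases hb : b = 0 <;> by_cases hb' : b' = 0 <;> simp [ratio, hb, hb'] at h ⊢
  rwa [div_eq_div_iff hb hb'] at h

theorem quotMap_eq_ratio {W : WeierstrassCurve ℂ} {P : W.toAffine.Point} {x z : ℂ}
    (h : IsXRep P x z) : quotMap W P = ratio x z := by
  obtain ⟨c, hc, rfl, rfl⟩ := h
  rw [ratio_mul hc]
  rcases P with _ | ⟨x, y, h⟩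
  · simp [quotMap, ratio, ← Affine.Point.zero_def]
  · simp [quotMap, ratio]

theorem cross_mul_of_isXRep {F : Type*} [Field F] {W : Affine F} {P : W.Point} {x z x' z' : F}
    (h : IsXRep P x z) (h' : IsXRep P x' z') : x * z' = x' * z := by
  obtain ⟨c, hc, rfl, rfl⟩ := h
  obtain ⟨c', hc', rfl, rfl⟩ := h'
  ring

theorem exists_num_denom_eq {A B : ℂ[X]} (h : IsCoprime A B) (hB : B ≠ 0) :
    ∃ c : ℂ, c ≠ 0 ∧ (ι A / ι B).num = C c * A ∧ (ι A / ι B).denom = C c * B := by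
  have e : (ι A / ι B).num * B = A * (ι A / ι B).denom :=
    (RatFunc.num_mul_eq_mul_denom_iff hB).mpr rfl
  obtain ⟨u, hu⟩ : B ∣ (ι A / ι B).denom :=
    h.symm.dvd_of_dvd_mul_left ⟨_, by rw [← e, mul_comm]⟩
  have hu' : IsUnit u := by
    have h1 : (ι A / ι B).denom ∣ B := RatFunc.denom_div_dvd A B
    rw [hu] at h1
    obtain ⟨v, hv⟩ := h1
    refine .of_mul_eq_one v (mul_left_cancel₀ hB ?_)
    rw [mul_one, ← mul_assoc, ← hv]
  obtain ⟨c, hc, rfl⟩ := Polynomial.isUnit_iff.mp hu'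
  refine ⟨c, hc.ne_zero, mul_right_cancel₀ hB ?_, by rw [hu, mul_comm]⟩
  rw [e, hu]
  ring

variable {W : WeierstrassCurve ℂ} {A B : ℕ → ℂ[X]}

theorem IsMulSeq.exists_num_denom (h : IsMulSeq W A B) {n : ℕ} (hn : 0 < n) :
    ∃ c : ℂ, c ≠ 0 ∧ (ι (A n) / ι (B n)).num = C c * A n ∧
      (ι (A n) / ι (B n)).denom = C c * B n := by
  obtain ⟨n, rfl⟩ := Nat.exists_eq_add_of_le' hn
  exact exists_num_denom_eq (h.coprime _) (h.B_ne_zero n)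

theorem IsMulSeq.degrees' (h : IsMulSeq W A B) {n : ℕ} (hn : 0 < n) :
    (A n).Monic ∧ (A n).natDegree = n ^ 2 ∧ (B n).natDegree = n ^ 2 - 1 ∧ B n ≠ 0 := by
  obtain ⟨n, rfl⟩ := Nat.exists_eq_add_of_le' hn
  exact ⟨(h.degrees n).1, (h.degrees n).2.1, (h.degrees n).2.2.1, h.B_ne_zero n⟩

theorem IsMulSeq.max_natDegree (h : IsMulSeq W A B) {n : ℕ} (hn : 0 < n) :
    max (ι (A n) / ι (B n)).num.natDegree (ι (A n) / ι (B n)).denom.natDegree = n ^ 2 := by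
  obtain ⟨c, hc, e₁, e₂⟩ := h.exists_num_denom hn
  obtain ⟨-, d₁, d₂, -⟩ := h.degrees' hn
  rw [e₁, e₂, natDegree_C_mul hc, natDegree_C_mul hc, d₁, d₂]
  omega

theorem IsMulSeq.ne_C (h : IsMulSeq W A B) {n : ℕ} (hn : 0 < n) :
    ¬ ∃ c, ι (A n) / ι (B n) = RatFunc.C c := by
  rintro ⟨c, hc⟩
  have := h.max_natDegree hn
  rw [hc, RatFunc.num_C, RatFunc.denom_C, natDegree_C, natDegree_one, max_self] at this
  exact (pow_pos hn 2).ne this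

/-- Since `π` is onto, compatibility with `[n]` fixes the map at every `x`, which gives an identity
of polynomials. For the converse, infinity goes to infinity because `deg B n < n²`. -/
theorem IsMulSeq.isLattesMap_iff [W.IsElliptic] (h : IsMulSeq W A B) {n : ℕ} (hn : 0 < n)
    (φ : RatFunc ℂ →ₐ[ℂ] RatFunc ℂ) :
    IsLattesMap W n φ ↔ φ RatFunc.X = ι (A n) / ι (B n) := by
  classical
  obtain ⟨m, d₁, d₂, hB⟩ := h.degrees' hn
  have hB' := RatFunc.algebraMap_ne_zero hB
  constructor
  · intro hφ
    have key : (φ RatFunc.X).num * B n = A n * (φ RatFunc.X).denom := by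
      refine Polynomial.funext fun x ↦ ?_
      obtain ⟨P, hP⟩ := quotMap_surjective W (x : OnePoint ℂ)
      rcases P with _ | ⟨x', y, hxy⟩
      · simp [quotMap] at hP
      · simp only [quotMap, OnePoint.coe_eq_coe] at hP
        subst hP
        have e := hφ (.some x' y hxy)
        rw [quotMap_eq_ratio (h.isXRep_nsmul hxy n)] at e
        have := cross_mul_of_ratio_eq e
        rw [eval_mul, eval_mul, this]
    rwa [RatFunc.num_mul_eq_mul_denom_iff hB] at key
  · intro hφ P
    obtain ⟨c, hc, e₁, e₂⟩ := h.exists_num_denom hn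
    rw [pointMap, hφ]
    rcases P with _ | ⟨x, y, hxy⟩
    · rw [← Affine.Point.zero_def, nsmul_zero]
      change OnePoint.infty = evalP1 _ none
      rw [evalP1, h.max_natDegree hn, e₁, e₂]
      have : (B n).coeff (n ^ 2) = 0 := coeff_eq_zero_of_natDegree_lt (by
        rw [d₂]
        have : 0 < n ^ 2 := by positivity
        omega)
      simp [ratio, this]
    · rw [quotMap_eq_ratio (h.isXRep_nsmul hxy n)]
      change _ = evalP1 _ (some x)
      rw [evalP1, e₁, e₂, eval_C_mul, eval_C_mul, ratio_mul hc]

theorem algHom_ext_X {φ ψ : RatFunc ℂ →ₐ[ℂ] RatFunc ℂ} (h : φ RatFunc.X = ψ RatFunc.X) :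
    φ = ψ := by
  refine AlgHom.coe_ringHom_injective (IsFractionRing.injective_comp_algebraMap (A := ℂ[X]) ?_)
  refine Polynomial.ringHom_ext (fun c ↦ ?_) ?_
  · simp [RatFunc.algebraMap_C, ← RatFunc.algebraMap_eq_C]
  · simpa using h

theorem exists_algHom_X {f : RatFunc ℂ} (hf : ¬ ∃ c, f = RatFunc.C c) :
    ∃ φ : RatFunc ℂ →ₐ[ℂ] RatFunc ℂ, φ RatFunc.X = f := by
  have ht := f.transcendental_of_ne_C hf
  exact ⟨(IntermediateField.val _).comp (RatFunc.algEquivOfTranscendental f ht).toAlgHom,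
    by simp⟩

theorem existsUnique_isLattesMap (W : WeierstrassCurve ℂ) [W.IsElliptic] {n : ℕ} (hn : 0 < n) :
    ∃! φ : RatFunc ℂ →ₐ[ℂ] RatFunc ℂ, IsLattesMap W n φ := by
  obtain ⟨A, B, h⟩ := exists_isMulSeq W
  obtain ⟨φ, hφ⟩ := exists_algHom_X (h.ne_C hn)
  refine ⟨φ, (h.isLattesMap_iff hn φ).mpr hφ, fun ψ hψ ↦ algHom_ext_X ?_⟩
  rw [(h.isLattesMap_iff hn ψ).mp hψ, hφ]

/-- The image of `φ` is `ℂ(φ x)`, so this is the degree of `ℂ(x)` over the subfield generated by one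
rational function. -/
theorem finrank_coverField (φ : RatFunc ℂ →ₐ[ℂ] RatFunc ℂ) :
    Module.finrank (RatFunc ℂ) (CoverField φ) =
      max (φ RatFunc.X).num.natDegree (φ RatFunc.X).denom.natDegree := by
  have hf : ¬ ∃ c, φ RatFunc.X = RatFunc.C c := by
    rintro ⟨c, hc⟩
    have : φ RatFunc.X = φ (RatFunc.C c) := by
      rw [hc]
      exact (φ.commutes c).symm
    have := φ.injective this
    rw [← RatFunc.algebraMap_X, ← RatFunc.algebraMap_C] at this
    exact X_ne_C c (RatFunc.algebraMap_injective ℂ this)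
  have ht := (φ RatFunc.X).transcendental_of_ne_C hf
  rw [← RatFunc.finrank_eq_max_natDegree]
  refine Algebra.finrank_eq_of_equiv_equiv
    (RatFunc.algEquivOfTranscendental (φ RatFunc.X) ht).toRingEquiv (RingEquiv.refl (RatFunc ℂ)) ?_
  have : (IntermediateField.val _).comp
      (RatFunc.algEquivOfTranscendental (φ RatFunc.X) ht).toAlgHom = φ :=
    algHom_ext_X (by simp)
  exact congr_arg AlgHom.toRingHom this

theorem IsMulSeq.finrank_coverField [W.IsElliptic] (h : IsMulSeq W A B) {n : ℕ} (hn : 0 < n)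
    {φ : RatFunc ℂ →ₐ[ℂ] RatFunc ℂ} (hφ : IsLattesMap W n φ) :
    Module.finrank (RatFunc ℂ) (CoverField φ) = n ^ 2 := by
  rw [Lattes.finrank_coverField, (h.isLattesMap_iff hn φ).mp hφ, h.max_natDegree hn]

end LattesMap

/-! ### Composition of Lattès maps and the tensor product -/

section Composition

local notation "ι" => algebraMap ℂ[X] (RatFunc ℂ)

/-- The rational function `g` is defined at `x` and takes the value `v` there. -/
def HasValue (x : ℂ) (g : RatFunc ℂ) (v : ℂ) : Prop :=
  g.denom.eval x ≠ 0 ∧ g.eval (RingHom.id ℂ) x = v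

theorem HasValue.add {x v v' : ℂ} {g g' : RatFunc ℂ} (h : HasValue x g v)
    (h' : HasValue x g' v') : HasValue x (g + g') (v + v') := by
  obtain ⟨h, rfl⟩ := h
  obtain ⟨h', rfl⟩ := h'
  refine ⟨fun h0 ↦ ?_, RatFunc.eval_add _ _ h h'⟩
  have := eval_eq_zero_of_dvd_of_eval_eq_zero (RatFunc.denom_add_dvd g g') h0
  rw [eval_mul] at this
  exact mul_ne_zero h h' this

theorem HasValue.mul {x v v' : ℂ} {g g' : RatFunc ℂ} (h : HasValue x g v)
    (h' : HasValue x g' v') : HasValue x (g * g') (v * v') := by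
  obtain ⟨h, rfl⟩ := h
  obtain ⟨h', rfl⟩ := h'
  refine ⟨fun h0 ↦ ?_, RatFunc.eval_mul _ _ h h'⟩
  have := eval_eq_zero_of_dvd_of_eval_eq_zero (RatFunc.denom_mul_dvd g g') h0
  rw [eval_mul] at this
  exact mul_ne_zero h h' this

theorem hasValue_algebraMap (x : ℂ) (p : ℂ[X]) : HasValue x (ι p) (p.eval x) := by
  simp [HasValue, RatFunc.eval]

theorem HasValue.pow {x v : ℂ} {g : RatFunc ℂ} (h : HasValue x g v) (n : ℕ) :
    HasValue x (g ^ n) (v ^ n) := by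
  induction n with
  | zero => simpa using hasValue_algebraMap x 1
  | succ n ih => simpa only [pow_succ] using ih.mul h

theorem HasValue.aeval {x v : ℂ} {g : RatFunc ℂ} (h : HasValue x g v) (p : ℂ[X]) :
    HasValue x (Polynomial.aeval g p) (p.eval v) := by
  induction p using Polynomial.induction_on' with
  | add p q hp hq => simpa using hp.add hq
  | monomial n a =>
    simpa [aeval_monomial] using (hasValue_algebraMap x (C a)).mul (h.pow n)

theorem hasValue_div {x : ℂ} {A B : ℂ[X]} (hB : B.eval x ≠ 0) :
    HasValue x (ι A / ι B) (A.eval x / B.eval x) := by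
  have hB0 : B ≠ 0 := by
    rintro rfl
    simp at hB
  have h1 : (ι A / ι B).denom.eval x ≠ 0 := fun h ↦
    hB (eval_eq_zero_of_dvd_of_eval_eq_zero (RatFunc.denom_div_dvd A B) h)
  refine ⟨h1, ?_⟩
  have e : (ι A / ι B).num * B = A * (ι A / ι B).denom :=
    (RatFunc.num_mul_eq_mul_denom_iff hB0).mpr rfl
  have := congr_arg (eval x) e
  rw [eval_mul, eval_mul] at this
  rw [RatFunc.eval, ← eval, ← eval]
  rwa [div_eq_div_iff h1 hB]

theorem eq_zero_of_hasValue {g : RatFunc ℂ} {B : ℂ[X]} (hB : B ≠ 0)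
    (h : ∀ x, B.eval x ≠ 0 → HasValue x g 0) : g = 0 := by
  have : g.num * B = 0 := by
    refine Polynomial.funext fun x ↦ ?_
    by_cases hx : B.eval x = 0
    · simp [hx]
    · obtain ⟨h1, h2⟩ := h x hx
      rw [RatFunc.eval, ← eval, ← eval, div_eq_zero_iff] at h2
      simp [h2.resolve_right h1]
  exact RatFunc.num_eq_zero_iff.mp ((mul_eq_zero.mp this).resolve_right hB)

variable {W : WeierstrassCurve ℂ} {A B : ℕ → ℂ[X]}

/-- Away from the zeros of `B m`, the multiple `mP` is affine with `x`-coordinate `A m / B m`, and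
`(lm)P = l(mP)` gives the identity of values. A rational function vanishing off a finite set is
zero. -/
theorem IsMulSeq.aeval_mul [W.IsElliptic] (h : IsMulSeq W A B) {l m : ℕ} (hm : 0 < m) :
    aeval (ι (A m) / ι (B m)) (A l) * ι (B (l * m)) =
      aeval (ι (A m) / ι (B m)) (B l) * ι (A (l * m)) := by
  classical
  rw [← sub_eq_zero]
  refine eq_zero_of_hasValue (h.degrees' hm).2.2.2 fun x hx ↦ ?_
  have hv := hasValue_div (A := A m) hx
  convert ((hv.aeval (A l)).mul (hasValue_algebraMap x (B (l * m)))).add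
    (((hv.aeval (B l)).mul (hasValue_algebraMap x (A (l * m)))).mul
      (hasValue_algebraMap x (-1))) using 1
  · simp [sub_eq_add_neg]
  · obtain ⟨P, hP⟩ := quotMap_surjective W (x : OnePoint ℂ)
    rcases P with _ | ⟨x', y, hxy⟩
    · simp [quotMap] at hP
    simp only [quotMap, OnePoint.coe_eq_coe] at hP
    subst hP
    have h1 := h.isXRep_nsmul hxy m
    have h2 := h.isXRep_nsmul hxy (l * m)
    rw [mul_nsmul'] at h2
    rcases hQ : m • Affine.Point.some x' y hxy with _ | ⟨x₁, y₁, hxy₁⟩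
    · obtain ⟨c, hc, -, e⟩ := h1
      rw [hQ] at e
      simp [← Affine.Point.zero_def] at e
      exact absurd e hx
    · obtain ⟨c, hc, e₁, e₂⟩ := h1
      rw [hQ] at e₁ e₂ h2
      simp at e₁ e₂
      have h3 := h.isXRep_nsmul hxy₁ l
      have := cross_mul_of_isXRep h3 h2
      rw [e₁, e₂, mul_div_cancel_left₀ _ hc, this]
      simp
      ring

theorem IsMulSeq.comp_eq [W.IsElliptic] (h : IsMulSeq W A B) {l m : ℕ} (hl : 0 < l) (hm : 0 < m)
    {φ ψ χ : RatFunc ℂ →ₐ[ℂ] RatFunc ℂ} (hφ : IsLattesMap W l φ) (hψ : IsLattesMap W m ψ)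
    (hχ : IsLattesMap W (l * m) χ) : ψ.comp φ = χ := by
  have hlm : 0 < l * m := Nat.mul_pos hl hm
  rw [h.isLattesMap_iff hl] at hφ
  rw [h.isLattesMap_iff hm] at hψ
  rw [h.isLattesMap_iff hlm] at hχ
  have hψp (p : ℂ[X]) : ψ (ι p) = aeval (ι (A m) / ι (B m)) p := by
    rw [← hψ, ← RatFunc.aeval_X_left_eq_algebraMap, aeval_algHom_apply]
  refine algHom_ext_X ?_
  have hB : ψ (ι (B l)) ≠ 0 :=
    (map_ne_zero ψ).mpr (RatFunc.algebraMap_ne_zero (h.degrees' hl).2.2.2)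
  rw [AlgHom.comp_apply, hφ, hχ, map_div₀, div_eq_div_iff hB
    (RatFunc.algebraMap_ne_zero (h.degrees' hlm).2.2.2), hψp, hψp, h.aeval_mul hm, mul_comm]

/-- A factorization of coverings gives an embedding of extensions of `ℂ(t)`. -/
def coverHom {φ ψ χ : RatFunc ℂ →ₐ[ℂ] RatFunc ℂ} (h : ψ.comp φ = χ) :
    CoverField φ →ₐ[RatFunc ℂ] CoverField χ :=
  { ψ.toRingHom with commutes' := fun x ↦ AlgHom.congr_fun h x }

/-- Coprime degrees make the two images linearly disjoint, so the multiplication map into `N` is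
injective; it is onto by equality of dimensions. -/
theorem nonempty_tensorProduct_algEquiv {K L M N : Type*} [Field K] [Field L] [Field M] [Field N]
    [Algebra K L] [Algebra K M] [Algebra K N] (f : L →ₐ[K] N) (g : M →ₐ[K] N)
    (hc : (Module.finrank K L).Coprime (Module.finrank K M))
    (hN : Module.finrank K N = Module.finrank K L * Module.finrank K M)
    (hpos : 0 < Module.finrank K N) : Nonempty (L ⊗[K] M ≃ₐ[K] N) := by
  have hfin : FiniteDimensional K N := .of_finrank_pos hpos
  have ef := AlgEquiv.ofInjectiveField f
  have eg := AlgEquiv.ofInjectiveField g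
  have hd : f.fieldRange.LinearDisjoint g.fieldRange := by
    refine .of_finrank_coprime ?_
    change (Module.finrank K f.range).Coprime (Module.finrank K g.range)
    rwa [← ef.toLinearEquiv.finrank_eq, ← eg.toLinearEquiv.finrank_eq]
  have hinj : Function.Injective (f.range.mulMap g.range) := by
    rw [IntermediateField.linearDisjoint_iff'] at hd
    exact hd.injective
  have hbij : Function.Bijective (f.range.mulMap g.range) := by
    refine ⟨hinj, ?_⟩
    refine (LinearMap.injective_iff_surjective_of_finrank_eq_finrank
      (f := (f.range.mulMap g.range).toLinearMap) ?_).mp hinj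
    rw [Module.finrank_tensorProduct, hN, ef.toLinearEquiv.finrank_eq, eg.toLinearEquiv.finrank_eq]
  exact ⟨(Algebra.TensorProduct.congr ef eg).trans (AlgEquiv.ofBijective _ hbij)⟩

theorem lattes_tensorProduct [W.IsElliptic] {l m : ℕ} (hl : 0 < l) (hm : 0 < m)
    (hlm : l.Coprime m) {φ ψ χ : RatFunc ℂ →ₐ[ℂ] RatFunc ℂ} (hφ : IsLattesMap W l φ)
    (hψ : IsLattesMap W m ψ) (hχ : IsLattesMap W (l * m) χ) :
    Nonempty (CoverField φ ⊗[RatFunc ℂ] CoverField ψ ≃ₐ[RatFunc ℂ] CoverField χ) := by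
  obtain ⟨A, B, h⟩ := exists_isMulSeq W
  have hlm' : 0 < l * m := Nat.mul_pos hl hm
  refine nonempty_tensorProduct_algEquiv (coverHom (h.comp_eq hl hm hφ hψ hχ))
    (coverHom (h.comp_eq hm hl hψ hφ (by rwa [mul_comm]))) ?_ ?_ ?_
  · rw [h.finrank_coverField hl hφ, h.finrank_coverField hm hψ]
    exact hlm.pow 2 2
  · rw [h.finrank_coverField hl hφ, h.finrank_coverField hm hψ, h.finrank_coverField hlm' hχ,
      mul_pow]
  · rw [h.finrank_coverField hlm' hχ]
    positivity

theorem isGenusZero_of_algEquiv {T : Type*} [CommRing T] [Algebra (RatFunc ℂ) T]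
    {χ : RatFunc ℂ →ₐ[ℂ] RatFunc ℂ} (e : T ≃ₐ[RatFunc ℂ] CoverField χ) : IsGenusZero T :=
  ⟨e.toRingEquiv, fun c ↦ (e.commutes _).trans (χ.commutes c)⟩

end Composition

/-! ### Uniformizers and ramification indices -/

section Uniformizer

variable {L : Type*} [Field L]

theorem valuation_eq_one_of_mem {w : ValuationSubring L} {u : L} (h₀ : u ≠ 0) (h : u ∈ w)
    (h' : u⁻¹ ∈ w) : w.valuation u = 1 := by
  rw [← w.valuation_le_one_iff] at h h'
  rw [map_inv₀] at h'
  exact le_antisymm h ((inv_le_one₀ (zero_lt_iff.mpr ((_root_.map_ne_zero _).mpr h₀))).mp h')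

theorem valuation_lt_one_of_inv_notMem {w : ValuationSubring L} {t : L} (h₀ : t ≠ 0)
    (h : t⁻¹ ∉ w) : w.valuation t < 1 := by
  rw [← w.valuation_le_one_iff, map_inv₀, not_le] at h
  exact (one_lt_inv₀ (zero_lt_iff.mpr ((_root_.map_ne_zero _).mpr h₀))).mp h

/-- Every element of the field is a power of `t` times a unit of the valuation ring `w`. -/
structure IsUniformizer (w : ValuationSubring L) (t : L) : Prop where
  ne_zero : t ≠ 0
  lt_one : w.valuation t < 1
  exists_eq (g : L) (hg : g ≠ 0) : ∃ (k : ℤ) (u : L), w.valuation u = 1 ∧ g = t ^ k * u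

/-- The value group of `w` is infinite cyclic on the value of `t`, and the values of `K` are the
powers of that of `s`, which is the `e`-th power. The index is that of `eℤ` in `ℤ`. -/
theorem IsUniformizer.ramificationIndex_eq {K : Type*} [Field K] [Algebra K L]
    {w : ValuationSubring L} {v : ValuationSubring K} {t u : L} {s : K} {e : ℤ}
    (ht : IsUniformizer w t) (hs : IsUniformizer v s) (hv : w.comap (algebraMap K L) = v)
    (hu : w.valuation u = 1) (hst : algebraMap K L s = t ^ e * u) :
    ramificationIndex K w = e.natAbs := by
  have hγ0 : w.valuation t ≠ 0 := (_root_.map_ne_zero _).mpr ht.ne_zero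
  set γ : w.ValueGroupˣ := Units.mk0 _ hγ0 with hγ
  have hinj (k : ℤ) (hk : γ ^ k = 1) : k = 0 := by
    exact (zpow_eq_one_iff_right₀ (zero_lt_iff.mpr hγ0).le ht.lt_one.ne).mp
      (by simpa [hγ] using congr_arg Units.val hk)
  have hsurj : Function.Surjective (zpowersHom _ γ) := by
    intro δ
    obtain ⟨g, hg⟩ := w.valuation_surjective δ
    have hg0 : g ≠ 0 := by
      rintro rfl
      exact δ.ne_zero (by rw [← hg, map_zero])
    obtain ⟨k, u, hu, rfl⟩ := ht.exists_eq g hg0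
    refine ⟨Multiplicative.ofAdd k, Units.ext ?_⟩
    rw [zpowersHom_apply, ← hg]
    simp [hu, hγ]
  -- Units of `v` stay units of `w`, because `w` restricts to `v`.
  have hval (g : Kˣ) : ∃ k : ℤ, g.1 = s ^ k * (g.1 / s ^ k) ∧
      w.valuation (algebraMap K L (g.1 / s ^ k)) = 1 := by
    obtain ⟨k, a, ha, h⟩ := hs.exists_eq g g.ne_zero
    have h2 : g.1 / s ^ k = a := by
      rw [h, mul_div_cancel_left₀ _ (zpow_ne_zero k hs.ne_zero)]
    refine ⟨k, by rw [h2, ← h], ?_⟩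
    rw [h2]
    have ha0 : a ≠ 0 := by
      rintro rfl
      simp at ha
    refine valuation_eq_one_of_mem ((_root_.map_ne_zero _).mpr ha0) ?_ ?_
    · have : a ∈ v := (v.valuation_le_one_iff a).mp ha.le
      rwa [← hv] at this
    · have : a⁻¹ ∈ v := (v.valuation_le_one_iff _).mp (by rw [map_inv₀, ha, inv_one])
      rw [← hv] at this
      rwa [← map_inv₀]
  rw [ramificationIndex, ← Subgroup.index_comap_of_surjective _ hsurj, ← Int.index_zmultiples,
    ← AddSubgroup.index_toSubgroup]
  congr 1
  ext k
  obtain ⟨k, rfl⟩ := Multiplicative.ofAdd.surjective k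
  simp only [Subgroup.mem_comap, MonoidHom.mem_range, zpowersHom_apply, toAdd_ofAdd]
  change _ ↔ k ∈ AddSubgroup.zmultiples e
  rw [Int.mem_zmultiples_iff]
  constructor
  · rintro ⟨g, hg⟩
    obtain ⟨j, h1, h2⟩ := hval g
    refine ⟨j, ?_⟩
    have : γ ^ (e * j - k) = 1 := by
      rw [zpow_sub, ← hg, mul_inv_eq_one]
      ext
      simp only [Units.val_zpow_eq_zpow_val, hγ, Units.val_mk0, MonoidHom.comp_apply,
        Units.coe_map, MonoidHom.coe_coe]
      rw [h1, map_mul, map_mul, h2, map_zpow₀, hst, map_zpow₀, map_mul, hu, map_zpow₀, mul_one,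
        mul_one, zpow_mul]
    have := hinj _ this
    omega
  · rintro ⟨j, rfl⟩
    refine ⟨(Units.mk0 s hs.ne_zero) ^ j, ?_⟩
    ext
    simp [hγ, hst, hu, zpow_mul]

/-- An element of `v` outside `w` would be `t ^ k * u` with `k < 0` and `u` a unit of both rings,
although `t` has value less than `1` in `v`. -/
theorem IsUniformizer.eq_of_le {w v : ValuationSubring L} {t : L} (ht : IsUniformizer w t)
    (hle : w ≤ v) (h : t⁻¹ ∉ v) : v = w := by
  refine le_antisymm (fun g hg ↦ ?_) hle
  by_contra hgw
  have hg0 : g ≠ 0 := by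
    rintro rfl
    exact hgw w.zero_mem
  obtain ⟨k, u, hu, rfl⟩ := ht.exists_eq g hg0
  rw [← w.valuation_le_one_iff, map_mul, hu, mul_one, map_zpow₀, not_le] at hgw
  have htv := valuation_lt_one_of_inv_notMem ht.ne_zero h
  have ht0 : v.valuation t ≠ 0 := (_root_.map_ne_zero _).mpr ht.ne_zero
  have hk : k < 0 := by
    by_contra! hk
    exact absurd hgw (zpow_le_one₀ (zero_lt_iff.mpr
      ((_root_.map_ne_zero _).mpr ht.ne_zero)) ht.lt_one.le hk).not_gt
  have hu0 : u ≠ 0 := by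
    rintro rfl
    simp at hu
  have huv : v.valuation u = 1 := valuation_eq_one_of_mem hu0
    (hle ((w.valuation_le_one_iff _).mp hu.le))
    (hle ((w.valuation_le_one_iff _).mp (by rw [map_inv₀, hu, inv_one])))
  rw [← v.valuation_le_one_iff, map_mul, huv, mul_one, map_zpow₀] at hg
  have := (zpow_right_strictAnti₀ (zero_lt_iff.mpr ht0) htv) hk
  simp only [zpow_zero] at this
  exact absurd this hg.not_gt

end Uniformizer

/-! ### Classification of the valuations of `ℂ(t)` -/

section RatFunc

local notation "ι" => algebraMap ℂ[X] (RatFunc ℂ)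

/-- The rational functions defined at `a`. -/
def pointRing (a : ℂ) : ValuationSubring (RatFunc ℂ) where
  carrier := {g | g.denom.eval a ≠ 0}
  zero_mem' := by simp
  one_mem' := by simp
  add_mem' {g g'} h h' h0 := by
    have := eval_eq_zero_of_dvd_of_eval_eq_zero (RatFunc.denom_add_dvd g g') h0
    rw [eval_mul] at this
    exact mul_ne_zero h h' this
  mul_mem' {g g'} h h' h0 := by
    have := eval_eq_zero_of_dvd_of_eval_eq_zero (RatFunc.denom_mul_dvd g g') h0
    rw [eval_mul] at this
    exact mul_ne_zero h h' this
  neg_mem' {g} h h0 := by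
    refine h (eval_eq_zero_of_dvd_of_eval_eq_zero ?_ h0)
    rw [RatFunc.denom_dvd (RatFunc.denom_ne_zero g)]
    exact ⟨-g.num, by rw [map_neg, neg_div, RatFunc.num_div_denom]⟩
  mem_or_inv_mem' g := by
    by_contra! h
    obtain ⟨h1, h2⟩ := h
    simp only [Set.mem_ofPred_eq, ne_eq, not_not] at h1 h2
    have hg : g ≠ 0 := by
      rintro rfl
      simp at h1
    have h3 := eval_eq_zero_of_dvd_of_eval_eq_zero (RatFunc.denom_inv_dvd hg) h2
    rcases eval_ne_zero_of_isCoprime g.isCoprime_num_denom a with h | h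
    · exact h h3
    · exact h h1

theorem mem_pointRing {a : ℂ} {g : RatFunc ℂ} : g ∈ pointRing a ↔ g.denom.eval a ≠ 0 := Iff.rfl

theorem div_mem_pointRing {a : ℂ} (p : ℂ[X]) {q : ℂ[X]} (hq : q.eval a ≠ 0) :
    ι p / ι q ∈ pointRing a :=
  (hasValue_div hq).1

theorem valuation_pointRing_div {a : ℂ} {p q : ℂ[X]} (hp : p.eval a ≠ 0) (hq : q.eval a ≠ 0) :
    (pointRing a).valuation (ι p / ι q) = 1 := by
  have h0 {r : ℂ[X]} (hr : r.eval a ≠ 0) : ι r ≠ 0 := RatFunc.algebraMap_ne_zero (by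
    rintro rfl
    simp at hr)
  refine valuation_eq_one_of_mem (div_ne_zero (h0 hp) (h0 hq)) (div_mem_pointRing p hq) ?_
  rw [inv_div]
  exact div_mem_pointRing q hp

theorem exists_eq_pow_mul (a : ℂ) {p : ℂ[X]} (hp : p ≠ 0) :
    ∃ q : ℂ[X], q.eval a ≠ 0 ∧ p = (X - C a) ^ p.rootMultiplicity a * q := by
  obtain ⟨q, h1, h2⟩ := p.exists_eq_pow_rootMultiplicity_mul_and_not_dvd hp a
  exact ⟨q, fun h ↦ h2 (dvd_iff_isRoot.mpr h), h1⟩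

theorem isUniformizer_pointRing (a : ℂ) : IsUniformizer (pointRing a) (ι (X - C a)) := by
  have h0 : ι (X - C a) ≠ 0 := RatFunc.algebraMap_ne_zero (X_sub_C_ne_zero a)
  refine ⟨h0, ?_, fun g hg ↦ ?_⟩
  · refine valuation_lt_one_of_inv_notMem h0 fun h ↦ ?_
    obtain ⟨c, hc, -, e⟩ := exists_num_denom_eq (A := 1) (B := X - C a) isCoprime_one_left
      (X_sub_C_ne_zero a)
    rw [mem_pointRing, inv_eq_one_div, ← map_one (algebraMap ℂ[X] (RatFunc ℂ)), e] at h
    simp at h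
  · obtain ⟨p, hp, e⟩ := exists_eq_pow_mul a (RatFunc.num_ne_zero hg)
    obtain ⟨q, hq, e'⟩ := exists_eq_pow_mul a g.denom_ne_zero
    refine ⟨(g.num.rootMultiplicity a : ℤ) - g.denom.rootMultiplicity a, ι p / ι q,
      valuation_pointRing_div hp hq, ?_⟩
    rw [zpow_sub₀ h0, zpow_natCast, zpow_natCast, div_mul_div_comm, ← map_pow, ← map_pow,
      ← map_mul, ← map_mul, ← e, ← e', RatFunc.num_div_denom]

/-- The rational functions defined at infinity. -/
def inftyRing : ValuationSubring (RatFunc ℂ) where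
  carrier := {g | g.intDegree ≤ 0}
  zero_mem' := by simp
  one_mem' := by simp
  add_mem' {g g'} h h' := by
    simp only [Set.mem_ofPred_eq] at *
    by_cases h0 : g + g' = 0
    · simp [h0]
    by_cases hg' : g' = 0
    · simpa [hg'] using h
    exact (RatFunc.intDegree_add_le hg' h0).trans (max_le h h')
  mul_mem' {g g'} h h' := by
    simp only [Set.mem_ofPred_eq] at *
    by_cases hg : g = 0
    · simp [hg]
    by_cases hg' : g' = 0
    · simp [hg']
    rw [RatFunc.intDegree_mul hg hg']
    omega
  neg_mem' {g} h := by simpa using h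
  mem_or_inv_mem' g := by
    simp only [Set.mem_ofPred_eq, RatFunc.intDegree_inv]
    omega

theorem mem_inftyRing {g : RatFunc ℂ} : g ∈ inftyRing ↔ g.intDegree ≤ 0 := Iff.rfl

theorem valuation_inftyRing {g : RatFunc ℂ} (hg : g ≠ 0) (h : g.intDegree = 0) :
    inftyRing.valuation g = 1 :=
  valuation_eq_one_of_mem hg (by rw [mem_inftyRing, h])
    (by rw [mem_inftyRing, RatFunc.intDegree_inv, h, neg_zero])

theorem intDegree_zpow {g : RatFunc ℂ} (hg : g ≠ 0) (k : ℤ) :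
    (g ^ k).intDegree = k * g.intDegree := by
  have hnat (n : ℕ) : (g ^ n).intDegree = n * g.intDegree := by
    induction n with
    | zero => simp
    | succ n ih =>
      rw [pow_succ, RatFunc.intDegree_mul (pow_ne_zero n hg) hg, ih]
      push_cast
      ring
  obtain ⟨n, rfl | rfl⟩ := k.eq_nat_or_neg
  · rw [zpow_natCast, hnat]
  · rw [zpow_neg, RatFunc.intDegree_inv, zpow_natCast, hnat]
    ring

theorem isUniformizer_inftyRing : IsUniformizer inftyRing (RatFunc.X⁻¹ : RatFunc ℂ) := by
  have h0 : (RatFunc.X⁻¹ : RatFunc ℂ) ≠ 0 := inv_ne_zero RatFunc.X_ne_zero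
  refine ⟨h0, ?_, fun g hg ↦ ?_⟩
  · refine valuation_lt_one_of_inv_notMem h0 fun h ↦ ?_
    rw [mem_inftyRing, inv_inv, RatFunc.intDegree_X] at h
    omega
  · refine ⟨-g.intDegree, g * RatFunc.X⁻¹ ^ g.intDegree, ?_, ?_⟩
    · have h1 := zpow_ne_zero g.intDegree h0
      refine valuation_inftyRing (mul_ne_zero hg h1) ?_
      rw [RatFunc.intDegree_mul hg h1, intDegree_zpow h0, RatFunc.intDegree_inv,
        RatFunc.intDegree_X]
      ring
    · rw [zpow_neg, mul_comm g, ← mul_assoc, inv_mul_cancel₀ (zpow_ne_zero _ h0), one_mul]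

variable {v : ValuationSubring (RatFunc ℂ)}

theorem eq_inftyRing (hC : ∀ c : ℂ, RatFunc.C c ∈ v) (hX : RatFunc.X ∉ v) : v = inftyRing := by
  have htriv : v.valuation.IsTrivialOn ℂ := by
    refine ⟨fun a ha ↦ ?_⟩
    rw [RatFunc.algebraMap_eq_C]
    refine valuation_eq_one_of_mem ((_root_.map_ne_zero _).mpr ha) (hC a) ?_
    rw [← map_inv₀]
    exact hC _
  rw [← v.valuation_le_one_iff, not_le] at hX
  refine isUniformizer_inftyRing.eq_of_le (fun g hg ↦ ?_) ?_
  · by_cases hg0 : g = 0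
    · rw [hg0]
      exact v.zero_mem
    rw [← v.valuation_le_one_iff,
      RatFunc.valuation_eq_valuation_X_zpow_intDegree_of_one_lt_valuation_X hX hg0]
    exact zpow_le_one_of_nonpos₀ hX.le hg
  · rwa [inv_inv, ← v.valuation_le_one_iff, not_le]

theorem algebraMap_mem (hC : ∀ c : ℂ, RatFunc.C c ∈ v) (hX : RatFunc.X ∈ v) (p : ℂ[X]) :
    ι p ∈ v := by
  induction p using Polynomial.induction_on' with
  | add p q hp hq =>
    rw [map_add]
    exact v.add_mem _ _ hp hq
  | monomial n a =>
    rw [← C_mul_X_pow_eq_monomial, map_mul, map_pow, RatFunc.algebraMap_C, RatFunc.algebraMap_X]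
    exact v.mul_mem _ _ (hC a) (pow_mem hX n)

/-- A polynomial not vanishing at `b` is a nonzero constant plus a multiple of `X - b`, hence a unit
of `v`. So `v` contains `pointRing b`, and maximality gives equality. -/
theorem eq_pointRing (hC : ∀ c : ℂ, RatFunc.C c ∈ v) (hX : RatFunc.X ∈ v) {b : ℂ}
    (hb : (ι (X - C b))⁻¹ ∉ v) : v = pointRing b := by
  refine (isUniformizer_pointRing b).eq_of_le (fun g hg ↦ ?_) hb
  have hlt := valuation_lt_one_of_inv_notMem
    (RatFunc.algebraMap_ne_zero (X_sub_C_ne_zero b)) hb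
  have hd : v.valuation (ι g.denom) = 1 := by
    obtain ⟨q, hq⟩ := X_sub_C_dvd_sub_C_eval (a := b) (p := g.denom)
    have e : g.denom = C (g.denom.eval b) + (X - C b) * q := by rw [← hq]; ring
    have h1 : v.valuation (ι (C (g.denom.eval b))) = 1 := by
      rw [RatFunc.algebraMap_C]
      refine valuation_eq_one_of_mem ((_root_.map_ne_zero _).mpr hg) (hC _) ?_
      rw [← map_inv₀]
      exact hC _
    have h2 : v.valuation (ι ((X - C b) * q)) < 1 := by
      rw [map_mul, map_mul]
      exact mul_lt_one_of_lt_of_le hlt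
        ((v.valuation_le_one_iff _).mpr (algebraMap_mem hC hX q))
    rw [e, map_add, Valuation.map_add_eq_of_lt_left, h1]
    rwa [h1]
  rw [← RatFunc.num_div_denom g, ← v.valuation_le_one_iff, map_div₀, hd, div_one,
    v.valuation_le_one_iff]
  exact algebraMap_mem hC hX _

/-- Otherwise all linear polynomials, and so all nonzero polynomials since they split over `ℂ`, are
invertible in `v`. -/
theorem exists_X_sub_C_inv_notMem (hC : ∀ c : ℂ, RatFunc.C c ∈ v) (hX : RatFunc.X ∈ v)
    (hv : v ≠ ⊤) : ∃ b : ℂ, (ι (X - C b))⁻¹ ∉ v := by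
  by_contra! h
  apply hv
  have key (n : ℕ) (q : ℂ[X]) (hn : q.natDegree = n) : (ι q)⁻¹ ∈ v := by
    induction n generalizing q with
    | zero =>
      rw [eq_C_of_natDegree_eq_zero hn, RatFunc.algebraMap_C, ← map_inv₀]
      exact hC _
    | succ n ih =>
      obtain ⟨r, hr⟩ := IsAlgClosed.exists_root q (fun h0 ↦ by
        rw [natDegree_eq_of_degree_eq_some (n := 0) h0] at hn
        omega)
      obtain ⟨s, rfl⟩ := dvd_iff_isRoot.mpr hr
      have hs : s ≠ 0 := by
        rintro rfl
        simp at hn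
      rw [natDegree_mul (X_sub_C_ne_zero r) hs, natDegree_X_sub_C] at hn
      rw [map_mul, mul_inv]
      exact v.mul_mem _ _ (h r) (ih s (by omega))
  refine eq_top_iff.mpr fun g _ ↦ ?_
  rw [← RatFunc.num_div_denom g, div_eq_mul_inv]
  exact v.mul_mem _ _ (algebraMap_mem hC hX _) (key _ _ rfl)

theorem pointRing_injective : Function.Injective pointRing := by
  intro a b h
  by_contra hab
  have h1 : (ι (X - C a))⁻¹ ∈ pointRing b := by
    rw [inv_eq_one_div, ← map_one (algebraMap ℂ[X] (RatFunc ℂ))]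
    exact div_mem_pointRing 1 (by simpa [sub_eq_zero] using Ne.symm hab)
  rw [← h, ← (pointRing a).valuation_le_one_iff, map_inv₀] at h1
  have := (isUniformizer_pointRing a)
  exact absurd h1 ((one_lt_inv₀ (zero_lt_iff.mpr ((_root_.map_ne_zero _).mpr this.ne_zero))).mpr
    this.lt_one).not_ge

theorem X_mem_pointRing (a : ℂ) : RatFunc.X ∈ pointRing a := by
  simp [mem_pointRing]

theorem X_notMem_inftyRing : RatFunc.X ∉ inftyRing := by
  simp [mem_inftyRing]

theorem C_mem_pointRing (a c : ℂ) : RatFunc.C c ∈ pointRing a := by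
  simp [mem_pointRing]

theorem C_mem_inftyRing (c : ℂ) : RatFunc.C c ∈ inftyRing := by
  simp [mem_inftyRing]

end RatFunc

/-! ### Multiple roots in the fibres of a Lattès map -/

section MultipleRoots

/-- If all roots of `Q` were simple, they would be `deg Q` distinct roots of `R`. -/
theorem exists_one_lt_rootMultiplicity {Q R : ℂ[X]} (hR : R ≠ 0)
    (hd : R.natDegree < Q.natDegree)
    (h : ∀ p, Q.eval p = 0 → (derivative Q).eval p ≠ 0 → R.eval p = 0) :
    ∃ p, 1 < Q.rootMultiplicity p := by
  by_contra! hle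
  have hQ : Q ≠ 0 := by
    rintro rfl
    simp at hd
  have hnd : Q.roots.Nodup :=
    Multiset.nodup_iff_count_le_one.mpr fun p ↦ by rw [count_roots]; exact hle p
  have hsub : Q.roots ≤ R.roots := (Multiset.le_iff_subset hnd).mpr fun p hp ↦ by
    rw [mem_roots hQ] at hp
    refine (mem_roots hR).mpr (h p hp fun h0 ↦ ?_)
    exact (hle p).not_gt ((one_lt_rootMultiplicity_iff_isRoot hQ).mpr ⟨hp, h0⟩)
  have h1 := Multiset.card_le_card hsub
  rw [IsAlgClosed.card_roots_eq_natDegree] at h1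
  exact absurd (h1.trans R.card_roots') (by omega)

variable {W : WeierstrassCurve ℂ} {A B : ℕ → ℂ[X]}

theorem Ψ₂Sq_ne_zero (W : WeierstrassCurve ℂ) : W.Ψ₂Sq ≠ 0 :=
  ne_zero_of_natDegree_gt (n := 2) (by rw [natDegree_cubic]; norm_num)

theorem eval_cubic (W : WeierstrassCurve ℂ) (x : ℂ) :
    W.Ψ₂Sq.eval x = 4 * x ^ 3 + W.b₂ * x ^ 2 + 2 * W.b₄ * x + W.b₆ := by
  simp [Ψ₂Sq]

theorem IsMulSeq.eval_cubic_mul_of_eval_B (h : IsMulSeq W A B) (n : ℕ) {p : ℂ}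
    (hp : (B (n + 1)).eval p = 0) :
    W.Ψ₂Sq.eval p * ((A (n + 1)).eval p * (derivative (B (n + 1))).eval p) ^ 2 = 0 := by
  have e := congr_arg (eval p) (h.wronskian_sq n)
  simp only [eval_mul, eval_sub, eval_pow, eval_add, eval_C, hp] at e
  linear_combination e

/-- Where `A = bB`, the Wronskian becomes `(A - bB)' B` and the cubic form becomes `B³ f(b)`. -/
theorem IsMulSeq.eval_cubic_mul_of_eval_A (h : IsMulSeq W A B) (n : ℕ) {p b : ℂ}
    (hp : (A (n + 1) - C b * B (n + 1)).eval p = 0) :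
    W.Ψ₂Sq.eval p *
        ((derivative (A (n + 1) - C b * B (n + 1))).eval p * (B (n + 1)).eval p) ^ 2 =
      ((n : ℂ) + 1) ^ 2 * (B (n + 1)).eval p ^ 4 * W.Ψ₂Sq.eval b := by
  have e := congr_arg (eval p) (h.wronskian_sq n)
  have hA : (A (n + 1)).eval p = b * (B (n + 1)).eval p := by
    simpa [sub_eq_zero] using hp
  rw [eval_cubic W b]
  simp only [eval_mul, eval_sub, eval_pow, eval_add, eval_C, hA] at e
  simp only [derivative_sub, derivative_C_mul, eval_sub, eval_mul, eval_C]
  linear_combination e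

/-- By the differential equation, simple roots of `B n` are among the three roots of the cubic,
while `deg B n = n² - 1 ≥ 8`. For `n = 2` the bound fails: `B 2` is the cubic itself. -/
theorem IsMulSeq.exists_multiple_root_B (h : IsMulSeq W A B) {n : ℕ} (hn : 2 < n) :
    ∃ p, 1 < (B n).rootMultiplicity p := by
  obtain ⟨-, -, hd, -⟩ := h.degrees' (n := n) (by omega)
  refine exists_one_lt_rootMultiplicity (Ψ₂Sq_ne_zero W) ?_ fun p hp hp' ↦ ?_
  · rw [natDegree_cubic, hd]
    have : 3 * 3 ≤ n * n := Nat.mul_le_mul hn hn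
    rw [pow_two]
    omega
  · obtain ⟨k, rfl⟩ := Nat.exists_eq_succ_of_ne_zero (by omega : n ≠ 0)
    have hA := (eval_ne_zero_of_isCoprime (h.coprime (k + 1)) p).resolve_right (not_not.mpr hp)
    exact (mul_eq_zero.mp (h.eval_cubic_mul_of_eval_B k hp)).resolve_right
      (pow_ne_zero 2 (mul_ne_zero hA hp'))

theorem IsMulSeq.natDegree_sub_C_mul (h : IsMulSeq W A B) {n : ℕ} (hn : 0 < n) (b : ℂ) :
    (A n - C b * B n).natDegree = n ^ 2 := by
  obtain ⟨-, hA, hB, -⟩ := h.degrees' hn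
  rw [natDegree_sub_eq_left_of_natDegree_lt, hA]
  refine (natDegree_C_mul_le _ _).trans_lt ?_
  rw [hA, hB]
  have := pow_pos hn 2
  omega

theorem IsMulSeq.sub_C_mul_ne_zero (h : IsMulSeq W A B) {n : ℕ} (hn : 0 < n) (b : ℂ) :
    A n - C b * B n ≠ 0 := fun h0 ↦ by
  have := h.natDegree_sub_C_mul hn b
  rw [h0, natDegree_zero] at this
  exact (pow_pos hn 2).ne this

theorem IsMulSeq.eval_B_ne_zero (h : IsMulSeq W A B) {n : ℕ} {p b : ℂ}
    (hp : (A n - C b * B n).eval p = 0) : (B n).eval p ≠ 0 := by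
  intro h0
  rw [eval_sub, eval_mul, h0, mul_zero, sub_zero] at hp
  exact (eval_ne_zero_of_isCoprime (h.coprime n) p).elim (absurd hp) (absurd h0)

theorem IsMulSeq.exists_multiple_root_sub (h : IsMulSeq W A B) {n : ℕ} (hn : 2 < n) {b : ℂ}
    (hb : W.Ψ₂Sq.eval b = 0) : ∃ p, 1 < (A n - C b * B n).rootMultiplicity p := by
  refine exists_one_lt_rootMultiplicity (Ψ₂Sq_ne_zero W) ?_ fun p hp hp' ↦ ?_
  · rw [natDegree_cubic, h.natDegree_sub_C_mul (by omega)]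
    have : 3 * 3 ≤ n * n := Nat.mul_le_mul hn hn
    rw [pow_two]
    omega
  · obtain ⟨k, rfl⟩ := Nat.exists_eq_succ_of_ne_zero (by omega : n ≠ 0)
    have e := h.eval_cubic_mul_of_eval_A k hp
    rw [hb, mul_zero] at e
    exact (mul_eq_zero.mp e).resolve_right
      (pow_ne_zero 2 (mul_ne_zero hp' (h.eval_B_ne_zero hp)))

theorem IsMulSeq.eval_cubic_eq_zero (h : IsMulSeq W A B) {n : ℕ} (hn : 0 < n) {p b : ℂ}
    (hp : 1 < (A n - C b * B n).rootMultiplicity p) : W.Ψ₂Sq.eval b = 0 := by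
  obtain ⟨k, rfl⟩ := Nat.exists_eq_succ_of_ne_zero hn.ne'
  obtain ⟨h1, h2⟩ := (one_lt_rootMultiplicity_iff_isRoot (h.sub_C_mul_ne_zero hn b)).mp hp
  have e := h.eval_cubic_mul_of_eval_A k h1
  rw [IsRoot.def] at h2
  rw [h2, zero_mul, zero_pow two_ne_zero, mul_zero] at e
  refine (mul_eq_zero.mp e.symm).resolve_left (mul_ne_zero (pow_ne_zero 2 ?_)
    (pow_ne_zero 4 (h.eval_B_ne_zero h1)))
  exact_mod_cast k.succ_ne_zero

/-- The two-torsion polynomial of an elliptic curve is separable. -/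
theorem nodup_roots_cubic (W : WeierstrassCurve ℂ) [W.IsElliptic] : W.Ψ₂Sq.roots.Nodup := by
  refine Multiset.nodup_iff_count_le_one.mpr fun r ↦ ?_
  rw [count_roots]
  by_contra! hr
  obtain ⟨h1, h2⟩ := (one_lt_rootMultiplicity_iff_isRoot (Ψ₂Sq_ne_zero W)).mp hr
  have e1 : 4 * r ^ 3 + W.b₂ * r ^ 2 + 2 * W.b₄ * r + W.b₆ = 0 := by
    rw [← eval_cubic]
    exact h1
  have e2 : 12 * r ^ 2 + 2 * W.b₂ * r + 2 * W.b₄ = 0 := by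
    have := h2
    simp [Ψ₂Sq] at this
    linear_combination this
  -- A double root `r` would be a base point of the forms at `(r, r)`: there `sumForm` is the cubic,
  -- and by `b_relation` `prodForm` lies in the ideal of the cubic and its derivative.
  refine forms_ne_zero (W := W) (x₁ := r) (z₁ := 1) (x₂ := r) (z₂ := 1) (.inr one_ne_zero)
    (.inr one_ne_zero) (by ring) ?_ ?_
  · rw [sumForm]
    linear_combination e1
  · have h4 := W.b_relation
    rw [prodForm]
    have : (4 : ℂ) * 4 ≠ 0 := by norm_num
    refine mul_left_cancel₀ this ?_
    linear_combination (12 * r ^ 2 + 2 * W.b₂ * r + 2 * W.b₄) * e2 -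
      (4 * W.b₂ + 32 * r) * e1 - 4 * h4

theorem encard_roots_cubic (W : WeierstrassCurve ℂ) [W.IsElliptic] :
    {b | W.Ψ₂Sq.eval b = 0}.encard = 3 := by
  have : {b | W.Ψ₂Sq.eval b = 0} = (W.Ψ₂Sq.roots.toFinset : Set ℂ) := by
    ext b
    simp [Ψ₂Sq_ne_zero W]
  rw [this, Set.encard_coe_eq_coe_finsetCard, Multiset.toFinset_card_of_nodup (nodup_roots_cubic W),
    IsAlgClosed.card_roots_eq_natDegree, natDegree_cubic]
  rfl

end MultipleRoots

/-! ### The branch points of a Lattès map -/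

section BranchSet

local notation "ι" => algebraMap ℂ[X] (RatFunc ℂ)

variable {φ : RatFunc ℂ →ₐ[ℂ] RatFunc ℂ} {A B : ℂ[X]}

/-- A valuation of `ℂ(t)` as a valuation of the source of the covering given by `φ`. -/
def coverValuation (φ : RatFunc ℂ →ₐ[ℂ] RatFunc ℂ) (w : ValuationSubring (RatFunc ℂ)) :
    ValuationSubring (CoverField φ) := w

theorem AlgHom.map_X_sub_C (hφ : φ RatFunc.X = ι A / ι B) (hB : B ≠ 0) (b : ℂ) :
    φ (ι (X - C b)) = ι (A - C b * B) / ι B := by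
  have hB' : ι B ≠ 0 := RatFunc.algebraMap_ne_zero hB
  rw [map_sub, map_sub, RatFunc.algebraMap_X, hφ, RatFunc.algebraMap_C, ← RatFunc.algebraMap_eq_C,
    φ.commutes, map_sub, map_mul, RatFunc.algebraMap_C, ← RatFunc.algebraMap_eq_C]
  field_simp

theorem C_mem_comap {w : ValuationSubring (RatFunc ℂ)} (hw : ∀ c : ℂ, RatFunc.C c ∈ w) (c : ℂ) :
    RatFunc.C c ∈ w.comap φ.toRingHom := by
  rw [ValuationSubring.mem_comap]
  have : φ.toRingHom (RatFunc.C c) = RatFunc.C c := φ.commutes c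
  rw [this]
  exact hw c

theorem mem_of_comap {w : ValuationSubring (RatFunc ℂ)}
    (hw : ∀ c : ℂ, RatFunc.C c ∈ w.comap φ.toRingHom) (c : ℂ) : RatFunc.C c ∈ w := by
  have := hw c
  rw [ValuationSubring.mem_comap] at this
  have e : φ.toRingHom (RatFunc.C c) = RatFunc.C c := φ.commutes c
  rwa [e] at this

theorem valuation_pointRing_div_lt_one {p : ℂ} {P Q : ℂ[X]} (hP0 : P ≠ 0) (hP : P.eval p = 0)
    (hQ : Q.eval p ≠ 0) : (pointRing p).valuation (ι P / ι Q) < 1 := by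
  obtain ⟨R, rfl⟩ := dvd_iff_isRoot.mpr hP
  rw [map_mul, mul_div_assoc, map_mul]
  exact mul_lt_one_of_lt_of_le (isUniformizer_pointRing p).lt_one
    (((pointRing p).valuation_le_one_iff _).mpr (div_mem_pointRing R hQ))

theorem comap_pointRing_of_eval_eq_zero (hφ : φ RatFunc.X = ι A / ι B) (hAB : IsCoprime A B)
    (hB : B ≠ 0) {p : ℂ} (hp : B.eval p = 0) : (pointRing p).comap φ.toRingHom = inftyRing := by
  refine eq_inftyRing (C_mem_comap (C_mem_pointRing p)) fun h ↦ ?_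
  have hA := (eval_ne_zero_of_isCoprime hAB p).resolve_right (not_not.mpr hp)
  rw [ValuationSubring.mem_comap] at h
  change φ RatFunc.X ∈ _ at h
  have h1 := valuation_pointRing_div_lt_one hB hp hA
  rw [← inv_div, ← hφ, map_inv₀] at h1
  rw [← ValuationSubring.valuation_le_one_iff] at h
  refine absurd h ((inv_lt_one₀ (zero_lt_iff.mpr ((_root_.map_ne_zero _).mpr ?_))).mp h1).not_ge
  rw [_root_.map_ne_zero]
  exact RatFunc.X_ne_zero

theorem ramificationIndex_pointRing_of_eval_eq_zero (hφ : φ RatFunc.X = ι A / ι B)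
    (hAB : IsCoprime A B) (hB : B ≠ 0) {p : ℂ} (hp : B.eval p = 0) :
    ramificationIndex (RatFunc ℂ) (coverValuation φ (pointRing p)) = B.rootMultiplicity p := by
  have hA := (eval_ne_zero_of_isCoprime hAB p).resolve_right (not_not.mpr hp)
  obtain ⟨Q, hQ, e⟩ := exists_eq_pow_mul p hB
  refine IsUniformizer.ramificationIndex_eq (w := coverValuation φ (pointRing p))
    (e := B.rootMultiplicity p)
    (isUniformizer_pointRing p) isUniformizer_inftyRing
    (comap_pointRing_of_eval_eq_zero hφ hAB hB hp) (valuation_pointRing_div hQ hA) ?_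
  change φ (RatFunc.X⁻¹) = (ι (X - C p)) ^ (B.rootMultiplicity p : ℤ) * (ι Q / ι A : RatFunc ℂ)
  rw [map_inv₀, hφ, inv_div, zpow_natCast, ← mul_div_assoc, ← map_pow, ← map_mul, ← e]

theorem comap_pointRing_of_eval_sub (hφ : φ RatFunc.X = ι A / ι B) {p b : ℂ}
    (hp : B.eval p ≠ 0) (hb : (A - C b * B).eval p = 0) (h0 : A - C b * B ≠ 0) :
    (pointRing p).comap φ.toRingHom = pointRing b := by
  have hB : B ≠ 0 := by
    rintro rfl
    simp at hp
  refine eq_pointRing (C_mem_comap (C_mem_pointRing p)) ?_ fun h ↦ ?_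
  · rw [ValuationSubring.mem_comap]
    change φ RatFunc.X ∈ _
    rw [hφ]
    exact div_mem_pointRing A hp
  · rw [ValuationSubring.mem_comap] at h
    change φ (ι (X - C b))⁻¹ ∈ _ at h
    rw [map_inv₀, AlgHom.map_X_sub_C hφ hB, ← ValuationSubring.valuation_le_one_iff, map_inv₀] at h
    refine absurd h ((one_lt_inv₀ (zero_lt_iff.mpr ((_root_.map_ne_zero _).mpr ?_))).mpr
      (valuation_pointRing_div_lt_one h0 hb hp)).not_ge
    exact div_ne_zero (RatFunc.algebraMap_ne_zero h0) (RatFunc.algebraMap_ne_zero hB)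

theorem ramificationIndex_pointRing_of_eval_sub (hφ : φ RatFunc.X = ι A / ι B) {p b : ℂ}
    (hp : B.eval p ≠ 0) (hb : (A - C b * B).eval p = 0) (h0 : A - C b * B ≠ 0) :
    ramificationIndex (RatFunc ℂ) (coverValuation φ (pointRing p)) =
      (A - C b * B).rootMultiplicity p := by
  have hB : B ≠ 0 := by
    rintro rfl
    simp at hp
  obtain ⟨Q, hQ, e⟩ := exists_eq_pow_mul p h0
  refine IsUniformizer.ramificationIndex_eq (w := coverValuation φ (pointRing p))
    (e := (A - C b * B).rootMultiplicity p)
    (isUniformizer_pointRing p) (isUniformizer_pointRing b)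
    (comap_pointRing_of_eval_sub hφ hp hb h0) (valuation_pointRing_div hQ hp) ?_
  change φ (ι (X - C b)) =
    (ι (X - C p)) ^ ((A - C b * B).rootMultiplicity p : ℤ) * (ι Q / ι B : RatFunc ℂ)
  rw [AlgHom.map_X_sub_C hφ hB, zpow_natCast, ← mul_div_assoc, ← map_pow, ← map_mul, ← e]

theorem intDegree_div {P Q : ℂ[X]} (hP : P ≠ 0) (hQ : Q ≠ 0) :
    (ι P / ι Q).intDegree = (P.natDegree : ℤ) - Q.natDegree := by
  rw [div_eq_mul_inv, RatFunc.intDegree_mul (RatFunc.algebraMap_ne_zero hP)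
    (inv_ne_zero (RatFunc.algebraMap_ne_zero hQ)), RatFunc.intDegree_inv,
    RatFunc.intDegree_polynomial, RatFunc.intDegree_polynomial, sub_eq_add_neg]

/-- By `hd`, `A / B` has a simple pole at infinity. -/
theorem ramificationIndex_inftyRing (hφ : φ RatFunc.X = ι A / ι B) (hA : A ≠ 0) (hB : B ≠ 0)
    (hd : A.natDegree = B.natDegree + 1) :
    ramificationIndex (RatFunc ℂ) (coverValuation φ inftyRing) = 1 := by
  have hX : (RatFunc.X : RatFunc ℂ) ≠ 0 := RatFunc.X_ne_zero
  have hφ0 : φ RatFunc.X ≠ 0 := (_root_.map_ne_zero _).mpr hX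
  have hdeg : (φ RatFunc.X).intDegree = 1 := by
    rw [hφ, intDegree_div hA hB, hd]
    push_cast
    ring
  have hcomap : inftyRing.comap φ.toRingHom = inftyRing := by
    refine eq_inftyRing (C_mem_comap C_mem_inftyRing) fun h ↦ ?_
    rw [ValuationSubring.mem_comap] at h
    change φ RatFunc.X ∈ _ at h
    rw [mem_inftyRing, hdeg] at h
    omega
  have hu : inftyRing.valuation (RatFunc.X / φ RatFunc.X) = 1 := by
    refine valuation_inftyRing (div_ne_zero hX hφ0) ?_
    rw [div_eq_mul_inv, RatFunc.intDegree_mul hX (inv_ne_zero hφ0), RatFunc.intDegree_inv, hdeg,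
      RatFunc.intDegree_X, add_neg_cancel]
  have hmap : φ (RatFunc.X⁻¹) = RatFunc.X⁻¹ ^ (1 : ℤ) * (RatFunc.X / φ RatFunc.X) := by
    rw [map_inv₀, zpow_one, div_eq_mul_inv, inv_mul_cancel_left₀ hX]
  exact IsUniformizer.ramificationIndex_eq (w := coverValuation φ inftyRing) (e := 1)
    isUniformizer_inftyRing isUniformizer_inftyRing hcomap hu hmap

theorem inftyRing_ne_top : inftyRing ≠ ⊤ := fun h ↦ X_notMem_inftyRing (h ▸ trivial)

theorem pointRing_ne_top (b : ℂ) : pointRing b ≠ ⊤ := fun h ↦ by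
  have := (isUniformizer_pointRing b).lt_one
  have h1 : (ι (X - C b))⁻¹ ∈ pointRing b := h ▸ trivial
  rw [← ValuationSubring.valuation_le_one_iff, map_inv₀] at h1
  exact absurd h1 ((one_lt_inv₀ (zero_lt_iff.mpr ((_root_.map_ne_zero _).mpr
    (isUniformizer_pointRing b).ne_zero))).mpr this).not_ge

/-- A Lattès map of degree greater than `4` is branched exactly over infinity and the roots of the
two-torsion polynomial. -/
theorem IsMulSeq.branchSet_coverField {W : WeierstrassCurve ℂ} {A B : ℕ → ℂ[X]}
    (h : IsMulSeq W A B) {n : ℕ} (hn : 2 < n) (hφ : φ RatFunc.X = ι (A n) / ι (B n)) :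
    branchSet (CoverField φ) = insert inftyRing (pointRing '' {b | W.Ψ₂Sq.eval b = 0}) := by
  obtain ⟨hmon, hdA, hdB, hB⟩ := h.degrees' (n := n) (by omega)
  ext v
  constructor
  · rintro ⟨hC, htop, w, rfl, hram⟩
    change ValuationSubring (RatFunc ℂ) at w
    change ∀ c : ℂ, RatFunc.C c ∈ w.comap φ.toRingHom at hC
    change w.comap φ.toRingHom ≠ ⊤ at htop
    change w.comap φ.toRingHom ∈ _
    change 1 < ramificationIndex (RatFunc ℂ) (coverValuation φ w) at hram
    have hCw := mem_of_comap hC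
    -- Either `w` is a finite point `p`, lying over infinity or over `A(p) / B(p)`, or it is the
    -- point at infinity, which is unramified.
    by_cases hX : RatFunc.X ∈ w
    · have hw : w ≠ ⊤ := by
        rintro rfl
        exact htop (eq_top_iff.mpr fun _ _ ↦ trivial)
      obtain ⟨p, hp⟩ := exists_X_sub_C_inv_notMem hCw hX hw
      obtain rfl := eq_pointRing hCw hX hp
      by_cases hBp : (B n).eval p = 0
      · exact .inl (comap_pointRing_of_eval_eq_zero hφ (h.coprime n) hB hBp)
      · have hb : (A n - C ((A n).eval p / (B n).eval p) * B n).eval p = 0 := by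
          simp [hBp]
        have h0 := h.sub_C_mul_ne_zero (n := n) (by omega) ((A n).eval p / (B n).eval p)
        refine .inr ⟨_, ?_, (comap_pointRing_of_eval_sub hφ hBp hb h0).symm⟩
        rw [ramificationIndex_pointRing_of_eval_sub hφ hBp hb h0] at hram
        exact h.eval_cubic_eq_zero (by omega) hram
    · obtain rfl := eq_inftyRing hCw hX
      rw [ramificationIndex_inftyRing hφ hmon.ne_zero hB] at hram
      · omega
      · have := pow_pos (by omega : 0 < n) 2
        omega
  · rintro (rfl | ⟨b, hb, rfl⟩)
    · obtain ⟨p, hp⟩ := h.exists_multiple_root_B hn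
      have hp0 : (B n).eval p = 0 := ((one_lt_rootMultiplicity_iff_isRoot hB).mp hp).1
      refine ⟨C_mem_inftyRing, inftyRing_ne_top, coverValuation φ (pointRing p),
        comap_pointRing_of_eval_eq_zero hφ (h.coprime n) hB hp0, ?_⟩
      rwa [ramificationIndex_pointRing_of_eval_eq_zero hφ (h.coprime n) hB hp0]
    · obtain ⟨p, hp⟩ := h.exists_multiple_root_sub hn hb
      have h0 := h.sub_C_mul_ne_zero (n := n) (by omega) b
      have hp0 := ((one_lt_rootMultiplicity_iff_isRoot h0).mp hp).1
      have hBp := h.eval_B_ne_zero hp0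
      refine ⟨C_mem_pointRing b, pointRing_ne_top b, coverValuation φ (pointRing p),
        comap_pointRing_of_eval_sub hφ hBp hp0 h0, ?_⟩
      rwa [ramificationIndex_pointRing_of_eval_sub hφ hBp hp0 h0]

theorem encard_branch (W : WeierstrassCurve ℂ) [W.IsElliptic] :
    (insert inftyRing (pointRing '' {b | W.Ψ₂Sq.eval b = 0})).encard = 4 := by
  rw [Set.encard_insert_of_notMem, pointRing_injective.encard_image, encard_roots_cubic]
  · norm_num
  · rintro ⟨b, -, hb⟩
    exact X_notMem_inftyRing (hb ▸ X_mem_pointRing b)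

end BranchSet

/-! ### Assembly, and an example attaining the bound -/

theorem lattes_cover (W : WeierstrassCurve ℂ) [W.IsElliptic] {l m : ℕ} (hl : 2 < l) (hm : 2 < m)
    (hlm : l.Coprime m) {φ ψ χ : RatFunc ℂ →ₐ[ℂ] RatFunc ℂ} (hφ : IsLattesMap W l φ)
    (hψ : IsLattesMap W m ψ) (hχ : IsLattesMap W (l * m) χ) :
    FiniteDimensional (RatFunc ℂ) (CoverField φ) ∧
    FiniteDimensional (RatFunc ℂ) (CoverField ψ) ∧
    (∃ S : Set (ValuationSubring (RatFunc ℂ)), S.encard = 4 ∧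
      branchSet (CoverField φ) = S ∧ branchSet (CoverField ψ) = S) ∧
    IsField (CoverField φ ⊗[RatFunc ℂ] CoverField ψ) ∧
    Nonempty ((CoverField φ ⊗[RatFunc ℂ] CoverField ψ) ≃ₐ[RatFunc ℂ] CoverField χ) ∧
    IsGenusZero (CoverField φ ⊗[RatFunc ℂ] CoverField ψ) := by
  obtain ⟨A, B, h⟩ := exists_isMulSeq W
  obtain ⟨e⟩ := lattes_tensorProduct (by omega) (by omega) hlm hφ hψ hχ
  refine ⟨.of_finrank_pos ?_, .of_finrank_pos ?_, ⟨_, encard_branch W,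
    h.branchSet_coverField hl ((h.isLattesMap_iff (by omega) φ).mp hφ),
    h.branchSet_coverField hm ((h.isLattesMap_iff (by omega) ψ).mp hψ)⟩,
    e.toMulEquiv.isField (Field.toIsField _), ⟨e⟩, isGenusZero_of_algEquiv e⟩
  · rw [h.finrank_coverField (by omega) hφ]
    positivity
  · rw [h.finrank_coverField (by omega) hψ]
    positivity

end Lattes

end

theorem mainTheorem7 :
    (∀ (W : WeierstrassCurve ℂ) [W.IsElliptic],
      (∀ n : ℕ, 0 < n → ∃! φ : RatFunc ℂ →ₐ[ℂ] RatFunc ℂ, Lattes.IsLattesMap W n φ) ∧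
      ∀ (l m : ℕ), 2 < l → 2 < m → Nat.Coprime l m →
        ∀ (φ ψ χ : RatFunc ℂ →ₐ[ℂ] RatFunc ℂ),
          Lattes.IsLattesMap W l φ → Lattes.IsLattesMap W m ψ →
          Lattes.IsLattesMap W (l * m) χ →
            FiniteDimensional (RatFunc ℂ) (Lattes.CoverField φ) ∧
            FiniteDimensional (RatFunc ℂ) (Lattes.CoverField ψ) ∧
            (∃ S : Set (ValuationSubring (RatFunc ℂ)), S.encard = 4 ∧
              Lattes.branchSet (Lattes.CoverField φ) = S ∧
              Lattes.branchSet (Lattes.CoverField ψ) = S) ∧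
            IsField (Lattes.CoverField φ ⊗[RatFunc ℂ] Lattes.CoverField ψ) ∧
            Nonempty ((Lattes.CoverField φ ⊗[RatFunc ℂ] Lattes.CoverField ψ)
              ≃ₐ[RatFunc ℂ] Lattes.CoverField χ) ∧
            Lattes.IsGenusZero (Lattes.CoverField φ ⊗[RatFunc ℂ] Lattes.CoverField ψ)) ∧
    (∃ (L M : Type) (_ : Field L) (_ : Field M)
      (_ : Algebra (RatFunc ℂ) L) (_ : Algebra (RatFunc ℂ) M),
        FiniteDimensional (RatFunc ℂ) L ∧ FiniteDimensional (RatFunc ℂ) M ∧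
        IsField (L ⊗[RatFunc ℂ] M) ∧ Lattes.IsGenusZero (L ⊗[RatFunc ℂ] M) ∧
        (Lattes.branchSet L).encard = 4 ∧ (Lattes.branchSet M).encard = 4) := by
  refine ⟨fun W _ ↦ ⟨fun n hn ↦ Lattes.existsUnique_isLattesMap W hn,
    fun l m hl hm hlm φ ψ χ hφ hψ hχ ↦ Lattes.lattes_cover W hl hm hlm hφ hψ hχ⟩, ?_⟩
  -- Any elliptic curve would do; this one is elliptic as soon as `2` is invertible. The integers
  -- `3` and `4` are the least coprime pair above `2`.
  let W := WeierstrassCurve.ofJ1728 ℂ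
  have : Fact (IsUnit (2 : ℂ)) := ⟨isUnit_iff_ne_zero.mpr two_ne_zero⟩
  have : W.IsElliptic := inferInstanceAs (WeierstrassCurve.ofJ1728 ℂ).IsElliptic
  obtain ⟨φ, hφ, -⟩ := Lattes.existsUnique_isLattesMap W (n := 3) (by norm_num)
  obtain ⟨ψ, hψ, -⟩ := Lattes.existsUnique_isLattesMap W (n := 4) (by norm_num)
  obtain ⟨χ, hχ, -⟩ := Lattes.existsUnique_isLattesMap W (n := 3 * 4) (by norm_num)
  obtain ⟨h1, h2, ⟨S, hS, h3, h4⟩, h5, -, h6⟩ :=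
    Lattes.lattes_cover W (by norm_num) (by norm_num) (by norm_num) hφ hψ hχ
  exact ⟨Lattes.CoverField φ, Lattes.CoverField ψ, inferInstance, inferInstance, inferInstance,
    inferInstance, h1, h2, h5, h6, h3 ▸ hS, h4 ▸ hS⟩
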